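/- Let $d\ge 1$ and $n\ge 1$ be integers, $D\subset\mathbb R^d$ an open set, $\varepsilon_0>0$, and let $(x,\varepsilon)\mapsto F_\varepsilon(x)\in\mathbb R^d$ be of class $C^{n+1}$ on $D\times[-\varepsilon_0,\varepsilon_0]$ and tangent to the identity, i.e. $F_0=\mathrm{id}$ on $D$ (equivalently $F_\varepsilon(x)=x+\varepsilon f_\varepsilon(x)$). Notation. For a family of vector fields $X_\varepsilon$, let $\Phi^1_{X_\varepsilon}$ be the time-one map of $\dot x=X_\varepsilon(x)$, along solutions that stay in $D$ for $t\in[0,1]$. We write $F_\varepsilon=\Phi^1_{X_\varepsilon}+O(\varepsilon^{N})$ uniformly on compact subsets of $D$ if for every compact $K\subset D$ there are $C,\delta>0$ such that for all $|\varepsilon|\le\delta$ and $x\in K$ the point $\Phi^1_{X_\varepsilon}(x)$ exists, is unique, and satisfies $|F_\varepsilon(x)-\Phi^1_{X_\varepsilon}(x)|\le C|\varepsilon|^{N}$. An inverse family of $F$ is a map $(\varepsilon,x)\mapsto F_\varepsilon^{-1}(x)$ that is continuous, has values in $D$, and satisfies $F_\varepsilon(F_\varepsilon^{-1}(x))=x$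 on some open neighbourhood of $\{0\}\times D$ in $\mathbb R\times\mathbb R^d$. For integers $m\ge1$ and $0\le n_0\le m$, the interpolating vector field of order $m$ (built with such an inverse family if $n_0>0$) is $$X_m(x,\varepsilon)=\sum_{k=-n_0}^{m-n_0}p_{mk}F_\varepsilon^k(x),\qquad p_{mk}=b_k'(0),\qquad b_k(t)=\prod_{\substack{-n_0\le j\le m-n_0\\ j\ne k}}\frac{t-j}{k-j},$$ where $F_\varepsilon^k$ is the $k$-th iterate of $F_\varepsilon$ for $k\ge 0$, and the $|k|$-th iterate of $F_\varepsilon^{-1}$ for $k<0$. Theorem. An inverse family of $F$ exists. There is a vector field $g_\varepsilon=\sum_{k=0}^{n-1}\varepsilon^k g_k$, polynomial in $\varepsilon$, with $C^1$ coefficients $g_k:D\to\mathbb R^d$, such that $$F_\varepsilon=\Phi^1_{\varepsilon g_\varepsilon}+O(\varepsilon^{n+1})$$ uniformly on compact subsets of $D$, and it is the unique vector field of this form (with $C^1$ coefficients on $D$) that has this property. Moreover, for all $1\le k\le m\le n$, all $0\le n_0\le m$, every choice of the inverse family and every $x\in D$, the function $\varepsilon\mapsto X_m(x,\varepsilon)$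 is $C^k$ near $\varepsilon=0$ and $$\frac1{k!}\left.\frac{\partial^kX_m}{\partial\varepsilon^k}(x,\varepsilon)\right|_{\varepsilon=0}=g_{k-1}(x).$$ For all $1\le m\le n$, all $0\le n_0\le m$ and every choice of the inverse family, $F_\varepsilon=\Phi^1_{X_m}+O(\varepsilon^{m+1})$ uniformly on compact subsets of $D$. -/

import Mathlib

namespace DiscreteAveraging

/-- `y` is the image of `x` under the time-one map `Φ¹_X` of the vector field `X` on `D`: the
solution of `γ' = X(γ)`, `γ(0) = x`, exists on `[0,1]`, stays in `D`, and `γ(1) = y`. -/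
def IsTimeOneImage {d : ℕ} (D : Set (EuclideanSpace ℝ (Fin d)))
    (X : EuclideanSpace ℝ (Fin d) → EuclideanSpace ℝ (Fin d))
    (x y : EuclideanSpace ℝ (Fin d)) : Prop :=
  ∃ γ : ℝ → EuclideanSpace ℝ (Fin d), γ 0 = x ∧ γ 1 = y ∧
    ∀ t ∈ Set.Icc (0 : ℝ) 1,
      γ t ∈ D ∧ HasDerivWithinAt γ (X (γ t)) (Set.Icc (0 : ℝ) 1) t

/-- `F_ε = Φ¹_{X_ε} + O(ε^N)` as `ε → 0`, uniformly on every compact subset of `D`: on every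
compact `K ⊆ D` and for all sufficiently small `|ε|`, the time-one map of `X_ε` is well defined
on `K` and differs from `F_ε` by at most `C |ε|^N`. -/
def ApproxByFlow {d : ℕ} (D : Set (EuclideanSpace ℝ (Fin d)))
    (F X : ℝ → EuclideanSpace ℝ (Fin d) → EuclideanSpace ℝ (Fin d)) (N : ℕ) : Prop :=
  ∀ K : Set (EuclideanSpace ℝ (Fin d)), IsCompact K → K ⊆ D →
    ∃ C δ : ℝ, 0 < δ ∧ ∀ ε : ℝ, |ε| ≤ δ → ∀ x ∈ K,
      (∃! y, IsTimeOneImage D (X ε) x y) ∧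
      ∀ y, IsTimeOneImage D (X ε) x y → ‖F ε x - y‖ ≤ C * |ε| ^ N

/-- `G` is an inverse family of `F` near `ε = 0`: on a neighbourhood of `{0} × D` the map
`(ε, x) ↦ G_ε(x)` is continuous with values in `D`, and `F_ε(G_ε(x)) = x`. When `F_0 = id` this
forces `G_0 = id` on `D`, so `G_ε(x)` is the preimage of `x` under `F_ε` that is close to `x`. -/
def IsInverseFamily {d : ℕ} (D : Set (EuclideanSpace ℝ (Fin d)))
    (F G : ℝ → EuclideanSpace ℝ (Fin d) → EuclideanSpace ℝ (Fin d)) : Prop :=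
  ∃ U : Set (ℝ × EuclideanSpace ℝ (Fin d)), IsOpen U ∧ (∀ x ∈ D, ((0 : ℝ), x) ∈ U) ∧
    ContinuousOn (fun p : ℝ × EuclideanSpace ℝ (Fin d) => G p.1 p.2) U ∧
    ∀ p ∈ U, G p.1 p.2 ∈ D ∧ F p.1 (G p.1 p.2) = p.2

/-- The `k`-th iterate of a map `F` for an integer `k`, where `G` plays the role of `F⁻¹`. -/
def intIterate {α : Type*} (F G : α → α) : ℤ → α → α
  | Int.ofNat k => F^[k]
  | Int.negSucc k => G^[k + 1]

/-- The weight `p_{mk} = b_k'(0)`, where `b_k` is the Lagrange basis polynomial of the node `k`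
for the nodes `-n₀, …, m - n₀`. -/
noncomputable def weight (n₀ m : ℕ) (k : ℤ) : ℝ :=
  (Polynomial.derivative
    (Lagrange.basis (Finset.Icc (-(n₀ : ℤ)) ((m : ℤ) - n₀)) (fun j : ℤ => (j : ℝ)) k)).eval 0

/-- The interpolating vector field `X_m(x) = ∑_{k=-n₀}^{m-n₀} p_{mk} F^k(x)` of order `m`. -/
noncomputable def interpField {d : ℕ} (n₀ m : ℕ)
    (F G : EuclideanSpace ℝ (Fin d) → EuclideanSpace ℝ (Fin d))
    (x : EuclideanSpace ℝ (Fin d)) : EuclideanSpace ℝ (Fin d) :=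
  ∑ k ∈ Finset.Icc (-(n₀ : ℤ)) ((m : ℤ) - n₀), weight n₀ m k • intIterate F G k x

/-- The vector field `ε g_ε(x)`, where `g_ε(x) = ∑_{k=0}^{n-1} ε^k g_k(x)`. -/
noncomputable def polyField {d n : ℕ}
    (g : Fin n → EuclideanSpace ℝ (Fin d) → EuclideanSpace ℝ (Fin d))
    (ε : ℝ) (x : EuclideanSpace ℝ (Fin d)) : EuclideanSpace ℝ (Fin d) :=
  ε • ∑ k : Fin n, ε ^ (k : ℕ) • g k x

end DiscreteAveraging

/-! Forward differences of the iterates gain a factor ε each time: the j-th difference at `k = 0` is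
O(ε^j) for j ≤ n + 1 (`iterDiff_isBigO`). So Newton's interpolation polynomial Q(t) of degree m
satisfies Q(k) = F_ε^k(x) + O(ε^(m+1)) at the integers k involved, negative ones included.

The weights of `X_m` differentiate polynomials of degree ≤ m exactly, so Q' = X_m(Q) + O(ε^(m+1)) at
the m + 1 nodes. Between the nodes, Q' is its own interpolant, while the i-th derivative of Q is
O(ε^i), so the (m+1)-st derivative of X_m(Q) and its interpolation error are O(ε^(m+1))
(`polynomial_curve_estimate`). Thus Q almost solves the equation of X_m on [0,1], running from
nearly x to nearly F_ε(x), and Grönwall's inequality compares F_ε with the time-one map of X_m.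

The coefficients g_k come from Taylor expansion of one field X_n in ε; truncation changes the flow
only by O(ε^(n+1)). If two polynomial fields first differ at ε^(k+1), so do their time-one maps,
which gives uniqueness (`eqOn_of_approxByFlow_polyField`). Uniqueness with m in place of n
identifies the Taylor coefficients of every X_m with the same g_k. -/

namespace DiscreteAveraging

open Filter Topology Asymptotics Set

/-! ### Taylor expansion in ε, locally uniform in x -/

section EpsCalculus

variable {E V : Type*} [NormedAddCommGroup E] [NormedSpace ℝ E]
  [NormedAddCommGroup V] [NormedSpace ℝ V]

/-- The partial derivative of `h (ε, x)` with respect to `ε`. -/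
noncomputable def epsDeriv (h : ℝ × E → V) (p : ℝ × E) : V := fderiv ℝ h p (1, 0)

/-- The remainder of the Taylor expansion of `h (ε, x)` in `ε` at `ε = 0`, up to order `j - 1`. -/
noncomputable def epsRem (h : ℝ × E → V) (j : ℕ) (p : ℝ × E) : V :=
  h p - ∑ i ∈ Finset.range j, (p.1 ^ i / (i.factorial : ℝ)) • epsDeriv^[i] h (0, p.2)

lemma contDiffAt_epsDeriv {h : ℝ × E → V} {p : ℝ × E} {r : ℕ}
    (hh : ContDiffAt ℝ ((r + 1 : ℕ) : WithTop ℕ∞) h p) :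
    ContDiffAt ℝ (r : WithTop ℕ∞) (epsDeriv h) p :=
  (hh.fderiv_right (m := (r : WithTop ℕ∞)) (by norm_cast)).clm_apply contDiffAt_const

lemma contDiffAt_iterate_epsDeriv (k : ℕ) {h : ℝ × E → V} {p : ℝ × E} {r : ℕ}
    (hh : ContDiffAt ℝ ((r + k : ℕ) : WithTop ℕ∞) h p) :
    ContDiffAt ℝ (r : WithTop ℕ∞) (epsDeriv^[k] h) p := by
  induction k generalizing h with
  | zero => simpa using hh
  | succ k ih =>
    rw [Function.iterate_succ_apply]
    exact ih (contDiffAt_epsDeriv (by simpa [add_assoc] using hh))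

lemma eventually_contDiffAt {h : ℝ × E → V} {p : ℝ × E} {r : ℕ}
    (hh : ContDiffAt ℝ (r : WithTop ℕ∞) h p) :
    ∀ᶠ q in 𝓝 p, ContDiffAt ℝ (r : WithTop ℕ∞) h q :=
  hh.eventually (by simp)

lemma hasDerivAt_epsDeriv {h : ℝ × E → V} {p : ℝ × E} {r : ℕ}
    (hh : ContDiffAt ℝ ((r + 1 : ℕ) : WithTop ℕ∞) h p) :
    HasDerivAt (fun s => h (s, p.2)) (epsDeriv h p) p.1 := by
  have h1 : HasFDerivAt h (fderiv ℝ h p) p := (hh.differentiableAt (by simp)).hasFDerivAt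
  have h2 : HasDerivAt (fun s : ℝ => (s, p.2)) ((1 : ℝ), (0 : E)) p.1 :=
    (hasDerivAt_id _).prodMk (hasDerivAt_const _ _)
  exact h1.comp_hasDerivAt p.1 h2

lemma hasDerivAt_sum_pow_div_factorial (j : ℕ) (c : ℕ → V) (s : ℝ) :
    HasDerivAt (fun s : ℝ => ∑ i ∈ Finset.range (j + 1), (s ^ i / (i.factorial : ℝ)) • c i)
      (∑ i ∈ Finset.range j, (s ^ i / (i.factorial : ℝ)) • c (i + 1)) s := by
  have h1 : (fun s : ℝ => ∑ i ∈ Finset.range (j + 1), (s ^ i / (i.factorial : ℝ)) • c i) =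
      fun s => (∑ i ∈ Finset.range j, (s ^ (i + 1) / ((i + 1).factorial : ℝ)) • c (i + 1)) + c 0 := by
    ext s
    rw [Finset.sum_range_succ']
    simp
  rw [h1]
  refine HasDerivAt.add_const _ (HasDerivAt.fun_sum fun i _ => ?_)
  refine HasDerivAt.smul_const ?_ _
  have h2 := (hasDerivAt_pow (i + 1) s).div_const ((i + 1).factorial : ℝ)
  convert h2 using 1
  rw [Nat.factorial_succ]
  have : (i.factorial : ℝ) ≠ 0 := by positivity
  push_cast
  field_simp

/-- The Taylor sum of `h` differentiates to that of `epsDeriv h`, one order lower; this drives the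
inductions below. -/
lemma hasDerivAt_epsRem (j : ℕ) {h : ℝ × E → V} {p : ℝ × E} {r : ℕ}
    (hh : ContDiffAt ℝ ((r + 1 : ℕ) : WithTop ℕ∞) h p) :
    HasDerivAt (fun s => epsRem h (j + 1) (s, p.2)) (epsRem (epsDeriv h) j p) p.1 :=
  (hasDerivAt_epsDeriv hh).sub
    (hasDerivAt_sum_pow_div_factorial j (fun i => epsDeriv^[i] h (0, p.2)) p.1)

lemma epsRem_succ_zero (j : ℕ) (h : ℝ × E → V) (y : E) : epsRem h (j + 1) (0, y) = 0 := by
  simp [epsRem, Finset.sum_range_succ']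

/-- Integrating a bound on the `ε`-derivative from `ε = 0`. -/
lemma isBigO_of_hasDerivAt {W : Type*} [TopologicalSpace W] {w₀ : W} {R R' : ℝ × W → V}
    {φ : W → ℝ} {j : ℕ} (h0 : ∀ᶠ w in 𝓝 w₀, R (0, w) = 0)
    (hd : ∀ᶠ p in 𝓝 ((0 : ℝ), w₀), HasDerivAt (fun s => R (s, p.2)) (R' p) p.1)
    (hO : R' =O[𝓝 ((0 : ℝ), w₀)] fun p => p.1 ^ j * φ p.2) :
    R =O[𝓝 ((0 : ℝ), w₀)] fun p => p.1 ^ (j + 1) * φ p.2 := by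
  obtain ⟨C, hC⟩ := hO.bound
  rw [nhds_prod_eq] at hd hC
  obtain ⟨pa, ha, pb, hb, hab⟩ := eventually_prod_iff.1 (hd.and hC)
  obtain ⟨η, hη, hηa⟩ := Metric.eventually_nhds_iff.1 ha
  refine IsBigO.of_bound C ?_
  rw [nhds_prod_eq]
  have hη' : ∀ᶠ s : ℝ in 𝓝 0, dist s 0 < η := Metric.eventually_nhds_iff.2 ⟨η, hη, fun _ h => h⟩
  filter_upwards [hη'.prod_mk (hb.and h0)] with p hp
  obtain ⟨hp1, hp2, hp3⟩ := hp
  have key : ‖R (p.1, p.2) - R (0, p.2)‖ ≤ C * ‖p.1 ^ j * φ p.2‖ * ‖p.1 - 0‖ := by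
    have hmem : ∀ s ∈ uIcc 0 p.1, |s| ≤ |p.1| := by
      intro s hs
      simpa using abs_sub_left_of_mem_uIcc hs
    refine (convex_uIcc (0 : ℝ) p.1).norm_image_sub_le_of_norm_hasDerivWithin_le
      (f := fun s => R (s, p.2)) (f' := fun s => R' (s, p.2)) ?_ ?_ left_mem_uIcc right_mem_uIcc
    · intro s hs
      refine (hab (x := s) (hηa ?_) hp2).1.hasDerivWithinAt
      simpa using (hmem s hs).trans_lt (by simpa using hp1)
    · intro s hs
      have h1 := (hab (x := s) (hηa (by simpa using (hmem s hs).trans_lt (by simpa using hp1)))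
        hp2).2
      refine h1.trans ?_
      rcases le_or_gt 0 C with hC0 | hC0
      · gcongr
        simp only [norm_mul, norm_pow, Real.norm_eq_abs]
        exact mul_le_mul_of_nonneg_right
          (pow_le_pow_left₀ (abs_nonneg _) (hmem s hs) _) (abs_nonneg _)
      -- A negative constant is possible only where the bounding function vanishes, and then the
      -- inequality is trivial.
      · have h2 : 0 ≤ C * ‖s ^ j * φ p.2‖ := (norm_nonneg _).trans h1
        have h3 : ‖s ^ j * φ p.2‖ = 0 := le_antisymm (by nlinarith) (norm_nonneg _)
        have h4 := hab (x := p.1) (hηa hp1) hp2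
        have h5 : 0 ≤ C * ‖p.1 ^ j * φ p.2‖ := (norm_nonneg _).trans h4.2
        simpa [h3] using h5
  rw [hp3, sub_zero] at key
  refine key.trans (le_of_eq ?_)
  simp only [norm_mul, norm_pow, sub_zero]
  ring

/-- Each integration in ε from 0 gains one power; the base case is local boundedness of a continuous
function. The bound is uniform for base points near `x`. -/
lemma epsRem_isBigO (j : ℕ) {h : ℝ × E → V} {x : E}
    (hh : ContDiffAt ℝ (j : WithTop ℕ∞) h (0, x)) :
    epsRem h j =O[𝓝 ((0 : ℝ), x)] fun p => p.1 ^ j := by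
  induction j generalizing h with
  | zero =>
    have : epsRem h 0 = h := by ext p; simp [epsRem]
    simpa [this] using hh.continuousAt.isBigO_one ℝ
  | succ j ih =>
    have := isBigO_of_hasDerivAt (R := epsRem h (j + 1)) (R' := epsRem (epsDeriv h) j)
      (φ := fun _ => 1) (j := j) (w₀ := x)
      (Eventually.of_forall fun y => epsRem_succ_zero j h y)
      ((eventually_contDiffAt hh).mono fun p hp => hasDerivAt_epsRem j hp)
      (by simpa using ih (contDiffAt_epsDeriv hh))
    simpa using this

/-- Same induction on increments. The base case is now a Lipschitz bound from strict
differentiability, which costs one more derivative. -/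
lemma epsRem_sub_isBigO (j : ℕ) {h : ℝ × E → V} {x : E}
    (hh : ContDiffAt ℝ ((j + 1 : ℕ) : WithTop ℕ∞) h (0, x)) :
    (fun q : ℝ × (E × E) => epsRem h j (q.1, q.2.1) - epsRem h j (q.1, q.2.2))
      =O[𝓝 ((0 : ℝ), (x, x))] fun q => q.1 ^ j * ‖q.2.1 - q.2.2‖ := by
  have t1 : Tendsto (fun q : ℝ × (E × E) => (q.1, q.2.1)) (𝓝 (0, (x, x))) (𝓝 (0, x)) :=
    Continuous.tendsto' (by fun_prop) _ _ rfl
  have t2 : Tendsto (fun q : ℝ × (E × E) => (q.1, q.2.2)) (𝓝 (0, (x, x))) (𝓝 (0, x)) :=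
    Continuous.tendsto' (by fun_prop) _ _ rfl
  induction j generalizing h with
  | zero =>
    have h1 := (hh.hasStrictFDerivAt (by simp)).isBigO_sub.comp_tendsto (t1.prodMk_nhds t2)
    have h2 : ∀ p, epsRem h 0 p = h p := by simp [epsRem]
    simp only [h2]
    refine h1.trans (IsBigO.of_bound 1 (Eventually.of_forall fun q => ?_))
    simp
  | succ j ih =>
    have e1 := t1.eventually (eventually_contDiffAt hh)
    have e2 := t2.eventually (eventually_contDiffAt hh)
    refine isBigO_of_hasDerivAt (w₀ := (x, x))
      (R := fun q : ℝ × (E × E) => epsRem h (j + 1) (q.1, q.2.1) - epsRem h (j + 1) (q.1, q.2.2))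
      (R' := fun q => epsRem (epsDeriv h) j (q.1, q.2.1) - epsRem (epsDeriv h) j (q.1, q.2.2))
      (φ := fun y => ‖y.1 - y.2‖) (j := j)
      (Eventually.of_forall fun y => by simp [epsRem_succ_zero]) ?_ (ih (contDiffAt_epsDeriv hh))
    filter_upwards [e1, e2] with q h1 h2
    exact (hasDerivAt_epsRem j h1).sub (hasDerivAt_epsRem j h2)

/-- Let s → 0 to kill the constant term, then divide by s, which is why the neighbourhood is
punctured. -/
lemma coeff_eq_zero_of_isBigO (j : ℕ) {c : ℕ → V}
    (h : (fun s : ℝ => ∑ i ∈ Finset.range j, s ^ i • c i) =O[𝓝[≠] 0] fun s => s ^ j) :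
    ∀ i < j, c i = 0 := by
  induction j generalizing c with
  | zero => simp
  | succ j ih =>
    have h0 : c 0 = 0 := by
      have t1 : Tendsto (fun s : ℝ => ∑ i ∈ Finset.range (j + 1), s ^ i • c i) (𝓝[≠] 0) (𝓝 0) :=
        h.trans_tendsto (tendsto_nhdsWithin_of_tendsto_nhds
          (Continuous.tendsto' (by fun_prop) _ _ (by simp)))
      have t2 : Tendsto (fun s : ℝ => ∑ i ∈ Finset.range (j + 1), s ^ i • c i) (𝓝[≠] 0)
          (𝓝 (c 0)) :=
        tendsto_nhdsWithin_of_tendsto_nhds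
          (Continuous.tendsto' (by fun_prop) _ _ (by simp [Finset.sum_range_succ']))
      exact tendsto_nhds_unique t2 t1
    have h1 : (fun s : ℝ => ∑ i ∈ Finset.range j, s ^ i • c (i + 1)) =O[𝓝[≠] 0]
        fun s => s ^ j := by
      obtain ⟨C, hC⟩ := h.bound
      refine IsBigO.of_bound C ?_
      filter_upwards [hC, self_mem_nhdsWithin] with s hs hs0
      have e : ∑ i ∈ Finset.range (j + 1), s ^ i • c i
          = s • ∑ i ∈ Finset.range j, s ^ i • c (i + 1) := by
        rw [Finset.sum_range_succ', Finset.smul_sum]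
        simp [h0, smul_smul, pow_succ']
      rw [e, norm_smul, pow_succ', norm_mul, mul_left_comm] at hs
      exact le_of_mul_le_mul_left hs (norm_pos_iff.2 hs0)
    intro i hi
    rcases i with _ | i
    · exact h0
    · exact ih h1 i (by omega)

lemma iterate_epsDeriv_eq_of_isBigO {j : ℕ} {h : ℝ × E → V} {x : E} {c : ℕ → V}
    (hh : ContDiffAt ℝ (j : WithTop ℕ∞) h (0, x))
    (hO : (fun s : ℝ => h (s, x) - ∑ i ∈ Finset.range j, s ^ i • c i) =O[𝓝 0] fun s => s ^ j) :
    ∀ i < j, (1 / (i.factorial : ℝ)) • epsDeriv^[i] h (0, x) = c i := by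
  have t : Tendsto (fun s : ℝ => (s, x)) (𝓝 0) (𝓝 (0, x)) :=
    Continuous.tendsto' (by fun_prop) _ _ rfl
  have h1 := hO.sub ((epsRem_isBigO j hh).comp_tendsto t)
  intro i hi
  have := coeff_eq_zero_of_isBigO j (V := V)
    (c := fun i => (1 / (i.factorial : ℝ)) • epsDeriv^[i] h (0, x) - c i) ?_ i hi
  · exact sub_eq_zero.1 this
  · refine (h1.congr_left fun s => ?_).mono nhdsWithin_le_nhds
    simp only [Function.comp, epsRem, smul_sub, Finset.sum_sub_distrib, smul_smul]
    simp only [mul_one_div]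
    abel

/-- A bound valid near (0, x) is also a bound near (0, y) for y close to x, so uniqueness of Taylor
coefficients applies on each such line. -/
lemma iterate_epsDeriv_eq_zero {j : ℕ} {h : ℝ × E → V} {x : E}
    (hh : ContDiffAt ℝ (j : WithTop ℕ∞) h (0, x)) (hO : h =O[𝓝 (0, x)] fun p => p.1 ^ j) :
    ∀ᶠ y in 𝓝 x, ∀ i < j, epsDeriv^[i] h (0, y) = 0 := by
  obtain ⟨C, hC⟩ := hO.bound
  have ty : Tendsto (fun y : E => ((0 : ℝ), y)) (𝓝 x) (𝓝 (0, x)) :=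
    Continuous.tendsto' (by fun_prop) _ _ rfl
  filter_upwards [ty.eventually (eventually_contDiffAt hh), ty.eventually hC.eventually_nhds]
    with y h1 h2 i hi
  have t : Tendsto (fun s : ℝ => (s, y)) (𝓝 0) (𝓝 (0, y)) :=
    Continuous.tendsto' (by fun_prop) _ _ rfl
  have h3 := iterate_epsDeriv_eq_of_isBigO (c := 0) h1
    (by simpa using IsBigO.of_bound C (t.eventually h2)) i hi
  simpa [Nat.factorial_ne_zero] using h3

/-- The increments in `x` of a `C^(j+1)` function which is `O(ε^j)` are `O(ε^j)` times the
increment of `x`. -/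
lemma sub_isBigO_of_isBigO {j : ℕ} {h : ℝ × E → V} {x : E}
    (hh : ContDiffAt ℝ ((j + 1 : ℕ) : WithTop ℕ∞) h (0, x))
    (hO : h =O[𝓝 (0, x)] fun p => p.1 ^ j) :
    (fun q : ℝ × (E × E) => h (q.1, q.2.1) - h (q.1, q.2.2))
      =O[𝓝 ((0 : ℝ), (x, x))] fun q => q.1 ^ j * ‖q.2.1 - q.2.2‖ := by
  have h0 := iterate_epsDeriv_eq_zero (hh.of_le (by norm_cast; omega)) hO
  have t1 : Tendsto (fun q : ℝ × (E × E) => q.2.1) (𝓝 (0, (x, x))) (𝓝 x) :=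
    Continuous.tendsto' (by fun_prop) _ _ rfl
  have t2 : Tendsto (fun q : ℝ × (E × E) => q.2.2) (𝓝 (0, (x, x))) (𝓝 x) :=
    Continuous.tendsto' (by fun_prop) _ _ rfl
  -- The Taylor coefficients vanish at all nearby points, so `h` coincides with its own remainder.
  refine (epsRem_sub_isBigO j hh).congr' ?_ EventuallyEq.rfl
  filter_upwards [t1.eventually h0, t2.eventually h0] with q hq1 hq2
  have e : ∀ p : ℝ × E, (∀ i < j, epsDeriv^[i] h (0, p.2) = 0) → epsRem h j p = h p := by
    intro p hp
    rw [epsRem, Finset.sum_eq_zero, sub_zero]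
    intro i hi
    rw [hp i (Finset.mem_range.1 hi), smul_zero]
  rw [e _ hq1, e _ hq2]

lemma iteratedDeriv_eq_iterate_epsDeriv (k : ℕ) {h : ℝ × E → V} {p : ℝ × E}
    (hh : ContDiffAt ℝ (k : WithTop ℕ∞) h p) :
    iteratedDeriv k (fun s => h (s, p.2)) p.1 = epsDeriv^[k] h p := by
  induction k generalizing h p with
  | zero => simp
  | succ k ih =>
    rw [iteratedDeriv_succ', Function.iterate_succ_apply, ← ih (contDiffAt_epsDeriv hh)]
    refine Filter.EventuallyEq.iteratedDeriv_eq k ?_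
    have t : Tendsto (fun s : ℝ => (s, p.2)) (𝓝 p.1) (𝓝 p) :=
      Continuous.tendsto' (by fun_prop) _ _ rfl
    filter_upwards [t.eventually (eventually_contDiffAt hh)] with s hs
    exact (hasDerivAt_epsDeriv hs).deriv

end EpsCalculus

/-! ### Forward differences of the iterates -/

section Differences

/-- The `j`-th forward difference at `k = 0` of the sequence of iterates `F_ε^k (x)`. -/
def iterDiff {E : Type*} [AddCommGroup E] (F : ℝ → E → E) : ℕ → ℝ × E → E
  | 0, p => p.2
  | j + 1, p => iterDiff F j (p.1, F p.1 p.2) - iterDiff F j p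

lemma iterDiff_iterate {E : Type*} [AddCommGroup E] (F : ℝ → E → E) (j : ℕ) (ε : ℝ) (y : E) (k : ℕ) :
    iterDiff F j (ε, (F ε)^[k] y) = (fwdDiff 1)^[j] (fun i : ℕ => (F ε)^[i] y) k := by
  induction j generalizing k with
  | zero => rfl
  | succ j ih =>
    rw [Function.iterate_succ_apply', fwdDiff, ← ih, ← ih, Function.iterate_succ_apply']
    rfl

variable {E : Type*} [NormedAddCommGroup E] [NormedSpace ℝ E]

/-- Newton's forward difference formula. Any upper limit beyond `k` is allowed because the further
binomials vanish; this lets the sum be cut at order m later. -/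
lemma iterate_eq_sum_iterDiff (F : ℝ → E → E) (p : ℝ × E) {k N : ℕ} (hk : k < N) :
    (F p.1)^[k] p.2 = ∑ j ∈ Finset.range N, (k.choose j : ℝ) • iterDiff F j p := by
  have h := shift_eq_sum_fwdDiff_iter (h := 1) (fun i : ℕ => (F p.1)^[i] p.2) k 0
  simp only [zero_add, smul_eq_mul, mul_one] at h
  rw [h, ← Finset.sum_subset (Finset.range_subset_range.2 (show k + 1 ≤ N by omega))]
  · refine Finset.sum_congr rfl fun j _ => ?_
    rw [← iterDiff_iterate, Nat.cast_smul_eq_nsmul]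
    rfl
  · intro j _ hj
    rw [Nat.choose_eq_zero_of_lt (by simpa using hj)]
    simp

variable {F : ℝ → E → E} {x : E} {n : ℕ}

lemma tendsto_fst_prodMk {E : Type*} [TopologicalSpace E] {x : E} {H : ℝ × E → E} (hF : ContinuousAt H (0, x)) (hx : H (0, x) = x) :
    Tendsto (fun p : ℝ × E => (p.1, H p)) (𝓝 (0, x)) (𝓝 (0, x)) := by
  have := (continuousAt_fst (p := ((0 : ℝ), x))).tendsto.prodMk_nhds hF.tendsto
  rwa [hx] at this

lemma contDiffAt_comp_fst_prodMk {V : Type*} [NormedAddCommGroup V] [NormedSpace ℝ V]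
    {h : ℝ × E → V} {H : ℝ × E → E} {r : WithTop ℕ∞}
    (hh : ContDiffAt ℝ r h (0, x)) (hF : ContDiffAt ℝ r H (0, x))
    (hx : H (0, x) = x) : ContDiffAt ℝ r (fun p => h (p.1, H p)) (0, x) := by
  refine ContDiffAt.comp (g := h) (f := fun p : ℝ × E => (p.1, H p)) (0, x) ?_
    (contDiffAt_fst.prodMk hF)
  simpa [hx] using hh

lemma contDiffAt_iterDiff {r : WithTop ℕ∞} (hF : ContDiffAt ℝ r (fun p : ℝ × E => F p.1 p.2) (0, x))
    (hx : F 0 x = x) (j : ℕ) : ContDiffAt ℝ r (iterDiff F j) (0, x) := by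
  induction j with
  | zero => exact contDiffAt_snd
  | succ j ih => exact (contDiffAt_comp_fst_prodMk ih hF hx).sub ih

lemma isBigO_of_eventually_zero {V : Type*} [NormedAddCommGroup V] [NormedSpace ℝ V]
    {h : ℝ × E → V} (hh : ContDiffAt ℝ 1 h (0, x)) (h0 : ∀ᶠ y in 𝓝 x, h (0, y) = 0) :
    h =O[𝓝 (0, x)] fun p => p.1 := by
  have h1 := epsRem_isBigO 1 (h := h) (x := x) (by simpa using hh)
  simp only [pow_one] at h1
  refine h1.congr' ?_ EventuallyEq.rfl
  filter_upwards [(continuousAt_snd (p := ((0 : ℝ), x))).tendsto.eventually h0] with p hp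
  simp [epsRem, hp]

/-- The next difference is the increment of the previous one between y and F_ε(y), which are O(ε)
apart, so `sub_isBigO_of_isBigO` gains a power of ε until the derivatives run out. -/
lemma iterDiff_isBigO
    (hF : ContDiffAt ℝ ((n + 1 : ℕ) : WithTop ℕ∞) (fun p : ℝ × E => F p.1 p.2) (0, x))
    (hx : ∀ᶠ y in 𝓝 x, F 0 y = y) (j : ℕ) :
    iterDiff F j =O[𝓝 (0, x)] fun p => p.1 ^ min j (n + 1) := by
  have hx' := hx.self_of_nhds
  induction j with
  | zero => simpa using (contDiffAt_iterDiff hF hx' 0).continuousAt.isBigO_one ℝ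
  | succ j ih =>
    rcases le_or_gt (n + 1) j with hj | hj
    -- Past order n + 1 nothing is gained: both terms of the difference are O(ε^(n+1)).
    · rw [min_eq_right hj] at ih
      rw [min_eq_right (by omega)]
      exact (ih.comp_tendsto (tendsto_fst_prodMk hF.continuousAt hx')).sub ih
    rw [min_eq_left hj.le] at ih
    rw [min_eq_left (by omega)]
    have h1 := sub_isBigO_of_isBigO (j := j)
      ((contDiffAt_iterDiff hF hx' j).of_le (by exact_mod_cast hj)) ih
    have h2 : (fun p : ℝ × E => F p.1 p.2 - p.2) =O[𝓝 (0, x)] fun p => p.1 := by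
      refine isBigO_of_eventually_zero ((hF.of_le (by norm_cast; omega)).sub contDiffAt_snd) ?_
      filter_upwards [hx] with y hy
      simp [hy]
    have t : Tendsto (fun p : ℝ × E => (p.1, (F p.1 p.2, p.2))) (𝓝 (0, x)) (𝓝 (0, (x, x))) := by
      have := (continuousAt_fst (p := ((0 : ℝ), x))).tendsto.prodMk_nhds
        (hF.continuousAt.tendsto.prodMk_nhds (continuousAt_snd (p := ((0 : ℝ), x))).tendsto)
      simpa [hx'] using this
    refine (h1.comp_tendsto t).trans ?_
    refine ((isBigO_refl (fun p : ℝ × E => p.1 ^ j) _).mul h2.norm_left).congr_right fun p => ?_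
    rw [pow_succ]

end Differences

/-! ### Local inverses of (ε, y) ↦ (ε, F_ε(y)) -/

section Inverse

variable {E : Type*} [NormedAddCommGroup E] [NormedSpace ℝ E]

variable {F : ℝ → E → E} {x : E} {n : ℕ}

/-- The shear `(a, v) ↦ (a, v + a • w)`. -/
def shearEquiv (w : E) : (ℝ × E) ≃L[ℝ] (ℝ × E) :=
  ContinuousLinearEquiv.equivOfInverse
    ((ContinuousLinearMap.fst ℝ ℝ E).prod
      (ContinuousLinearMap.snd ℝ ℝ E + (ContinuousLinearMap.fst ℝ ℝ E).smulRight w))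
    ((ContinuousLinearMap.fst ℝ ℝ E).prod
      (ContinuousLinearMap.snd ℝ ℝ E - (ContinuousLinearMap.fst ℝ ℝ E).smulRight w))
    (fun p => by simp) (fun p => by simp)

/-- Since F_0 is the identity near `x`, the derivative in y is the identity and only the ε-column is
left; a shear is invertible. -/
lemma hasFDerivAt_shear
    (hF : ContDiffAt ℝ ((n + 1 : ℕ) : WithTop ℕ∞) (fun p : ℝ × E => F p.1 p.2) (0, x))
    (hx : ∀ᶠ y in 𝓝 x, F 0 y = y) :
    HasFDerivAt (fun p : ℝ × E => (p.1, F p.1 p.2))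
      (shearEquiv (epsDeriv (fun p : ℝ × E => F p.1 p.2) (0, x)) : (ℝ × E) →L[ℝ] ℝ × E) (0, x) := by
  have h1 := (hF.differentiableAt (by simp)).hasFDerivAt
  have h2 : ∀ v : E, fderiv ℝ (fun p : ℝ × E => F p.1 p.2) (0, x) (0, v) = v := by
    intro v
    have h3 : HasFDerivAt (fun y : E => ((0 : ℝ), y)) (ContinuousLinearMap.inr ℝ ℝ E) x :=
      hasFDerivAt_prodMk_right 0 x
    have h4 := HasFDerivAt.comp (g := fun p : ℝ × E => F p.1 p.2) x h1 h3
    have h5 : HasFDerivAt (fun y : E => F 0 y) (ContinuousLinearMap.id ℝ E) x :=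
      (hasFDerivAt_id x).congr_of_eventuallyEq hx
    have h6 := congrArg (fun L => L v) (h4.unique h5)
    simpa using h6
  have h7 := (hasFDerivAt_fst (𝕜 := ℝ) (p := ((0 : ℝ), x))).prodMk h1
  refine h7.congr_fderiv ?_
  ext1
  · ext1
    simp [shearEquiv, epsDeriv]
  · ext v <;> simp [shearEquiv, h2]

variable [CompleteSpace E]

/-- Near `(0, x)` the map `(ε, y) ↦ (ε, F_ε y)` is invertible, with an inverse of the same form. -/
lemma exists_local_inverse
    (hF : ContDiffAt ℝ ((n + 1 : ℕ) : WithTop ℕ∞) (fun p : ℝ × E => F p.1 p.2) (0, x))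
    (hx : ∀ᶠ y in 𝓝 x, F 0 y = y) :
    ∃ H : ℝ × E → E, ContDiffAt ℝ ((n + 1 : ℕ) : WithTop ℕ∞) H (0, x) ∧ H (0, x) = x ∧
      (∀ᶠ p in 𝓝 ((0 : ℝ), x), F p.1 (H p) = p.2) ∧
      ∀ᶠ p in 𝓝 ((0 : ℝ), x), H (p.1, F p.1 p.2) = p.2 := by
  have hx' := hx.self_of_nhds
  have hΨ : ContDiffAt ℝ ((n + 1 : ℕ) : WithTop ℕ∞) (fun p : ℝ × E => (p.1, F p.1 p.2)) (0, x) :=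
    contDiffAt_fst.prodMk hF
  have hd := hasFDerivAt_shear hF hx
  have hs := hΨ.hasStrictFDerivAt' hd (by simp)
  set L := hs.localInverse (fun p : ℝ × E => (p.1, F p.1 p.2)) _ (0, x) with hL
  have hLs : ContDiffAt ℝ ((n + 1 : ℕ) : WithTop ℕ∞) L (0, x) := by
    have : ContDiffAt ℝ ((n + 1 : ℕ) : WithTop ℕ∞) L (0, F 0 x) :=
      hΨ.to_localInverse hd (by simp)
    rwa [hx'] at this
  have hr := hs.eventually_right_inverse
  have hl := hs.eventually_left_inverse
  have h0 := hs.localInverse_apply_image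
  rw [← hL] at hr hl h0
  simp only [hx'] at hr h0
  refine ⟨fun p => (L p).2, hLs.snd, by simp [h0], ?_, ?_⟩
  · filter_upwards [hr] with p hp
    have h1 := congrArg Prod.fst hp
    have h2 := congrArg Prod.snd hp
    simp only at h1 h2
    rw [← h1, h2]
  · filter_upwards [hl] with p hp
    rw [hp]

/-- A continuous right inverse close to the identity is as smooth as `F`, and a left inverse. -/
lemma contDiffAt_of_rightInverse {G : ℝ → E → E}
    (hF : ContDiffAt ℝ ((n + 1 : ℕ) : WithTop ℕ∞) (fun p : ℝ × E => F p.1 p.2) (0, x))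
    (hx : ∀ᶠ y in 𝓝 x, F 0 y = y)
    (hG : ContinuousAt (fun p : ℝ × E => G p.1 p.2) (0, x)) (hGx : G 0 x = x)
    (hFG : ∀ᶠ p in 𝓝 ((0 : ℝ), x), F p.1 (G p.1 p.2) = p.2) :
    ContDiffAt ℝ ((n + 1 : ℕ) : WithTop ℕ∞) (fun p : ℝ × E => G p.1 p.2) (0, x) ∧
      ∀ᶠ p in 𝓝 ((0 : ℝ), x), G p.1 (F p.1 p.2) = p.2 := by
  have hx' := hx.self_of_nhds
  obtain ⟨H, hHs, hH0, hr, hl⟩ := exists_local_inverse hF hx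
  have hGH : (fun p : ℝ × E => G p.1 p.2) =ᶠ[𝓝 (0, x)] H := by
    -- Evaluating the left-inverse identity of `H` at (ε, G_ε(y)) gives H(ε, y) = G_ε(y).
    filter_upwards [(tendsto_fst_prodMk hG hGx).eventually hl, hFG] with p h1 h2
    simp only [h2] at h1
    exact h1.symm
  refine ⟨hHs.congr_of_eventuallyEq hGH, ?_⟩
  filter_upwards [(tendsto_fst_prodMk hF.continuousAt hx').eventually hGH, hl] with p h1 h2
  exact h1.trans h2

end Inverse

/-! ### Existence and smoothness of inverse families -/

section InverseFamily

variable {d n : ℕ} {D : Set (EuclideanSpace ℝ (Fin d))}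
  {F : ℝ → EuclideanSpace ℝ (Fin d) → EuclideanSpace ℝ (Fin d)}

/-- The local inverses are glued by a choice independent of the chart: G_ε(y) is a preimage of y
nearest to y. Near (0, x) it is forced to be the local inverse, hence continuous. -/
lemma exists_isInverseFamily (hD : IsOpen D)
    (hF : ∀ x ∈ D, ContDiffAt ℝ ((n + 1 : ℕ) : WithTop ℕ∞)
      (fun p : ℝ × EuclideanSpace ℝ (Fin d) => F p.1 p.2) (0, x))
    (hF0 : ∀ x ∈ D, F 0 x = x) : ∃ G, IsInverseFamily D F G := by
  classical
  let Near : ℝ → EuclideanSpace ℝ (Fin d) → EuclideanSpace ℝ (Fin d) → Prop := fun ε y z =>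
    z ∈ D ∧ F ε z = y ∧ ∀ w ∈ D, F ε w = y → ‖z - y‖ ≤ ‖w - y‖
  let G : ℝ → EuclideanSpace ℝ (Fin d) → EuclideanSpace ℝ (Fin d) := fun ε y =>
    if h : ∃ z, Near ε y z then h.choose else 0
  have hG : ∀ ε y, (∃ z, Near ε y z) → Near ε y (G ε y) := by
    intro ε y h
    simp only [G, dif_pos h]
    exact h.choose_spec
  have hloc : ∀ x ∈ D, ∀ᶠ p in 𝓝 ((0 : ℝ), x),
      ContinuousAt (fun p : ℝ × EuclideanSpace ℝ (Fin d) => G p.1 p.2) p ∧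
        G p.1 p.2 ∈ D ∧ F p.1 (G p.1 p.2) = p.2 := by
    intro x hx
    have hxe : ∀ᶠ y in 𝓝 x, F 0 y = y := by
      filter_upwards [hD.mem_nhds hx] with y hy using hF0 y hy
    obtain ⟨H, hHs, hH0, hr, hl⟩ := exists_local_inverse (hF x hx) hxe
    obtain ⟨η, hη, hηl⟩ := Metric.eventually_nhds_iff.1 hl
    have tH : Tendsto H (𝓝 (0, x)) (𝓝 x) := by simpa only [hH0] using hHs.continuousAt.tendsto
    have ty : Tendsto (fun p : ℝ × EuclideanSpace ℝ (Fin d) => p.2) (𝓝 (0, x)) (𝓝 x) :=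
      continuousAt_snd
    have te : Tendsto (fun p : ℝ × EuclideanSpace ℝ (Fin d) => p.1) (𝓝 (0, x)) (𝓝 0) :=
      continuousAt_fst
    have hGH : ∀ᶠ p in 𝓝 ((0 : ℝ), x), G p.1 p.2 = H p := by
      filter_upwards [hr, tH.eventually (hD.mem_nhds hx),
        tH.eventually (Metric.ball_mem_nhds x (show 0 < η / 4 by positivity)),
        ty.eventually (Metric.ball_mem_nhds x (show 0 < η / 4 by positivity)),
        te.eventually (Metric.ball_mem_nhds 0 hη)] with p h1 h2 h3 h4 h5
      -- A preimage no farther from y than `H p` lies within 3η/4 of `x`, where the left-inverse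
      -- identity pins it down.
      have huniq : ∀ w ∈ D, F p.1 w = p.2 → ‖w - p.2‖ ≤ ‖H p - p.2‖ → w = H p := by
        intro w _ hwF hw
        have hd : dist w x < η := by
          calc dist w x ≤ dist w p.2 + dist p.2 x := dist_triangle _ _ _
            _ ≤ dist (H p) p.2 + dist p.2 x := by
              gcongr; simpa only [dist_eq_norm] using hw
            _ ≤ (dist (H p) x + dist p.2 x) + dist p.2 x := by
              gcongr; exact dist_triangle_right _ _ _
            _ < η := by
              have h3' : dist (H p) x < η / 4 := h3
              have h4' : dist p.2 x < η / 4 := h4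
              linarith
        have := hηl (y := (p.1, w)) (by
          rw [Prod.dist_eq]; exact max_lt (by simpa using h5) hd)
        simp only [hwF] at this
        exact this.symm
      have hN : Near p.1 p.2 (H p) := by
        refine ⟨h2, h1, fun w hw hwF => ?_⟩
        by_contra hlt
        rw [huniq w hw hwF (le_of_not_ge hlt)] at hlt
        exact hlt le_rfl
      obtain ⟨g1, g2, g3⟩ := hG p.1 p.2 ⟨_, hN⟩
      exact huniq _ g1 g2 (g3 _ h2 h1)
    filter_upwards [hGH.eventually_nhds, hr, tH.eventually (hD.mem_nhds hx),
      eventually_contDiffAt hHs] with p h1 h2 h3 h4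
    refine ⟨h4.continuousAt.congr (h1.mono fun q hq => hq.symm), ?_, ?_⟩
    · rwa [h1.self_of_nhds]
    · rwa [h1.self_of_nhds]
  refine ⟨G, {p | ∀ᶠ q in 𝓝 p, ContinuousAt
    (fun p : ℝ × EuclideanSpace ℝ (Fin d) => G p.1 p.2) q ∧
      G q.1 q.2 ∈ D ∧ F q.1 (G q.1 q.2) = q.2}, isOpen_setOfPred_eventually_nhds, hloc, ?_, ?_⟩
  · intro p hp
    exact (Eventually.self_of_nhds hp).1.continuousWithinAt
  · intro p hp
    exact (Eventually.self_of_nhds hp).2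

/-- An inverse family is a smooth two-sided local inverse near `ε = 0`. -/
lemma IsInverseFamily.contDiffAt {G} (hG : IsInverseFamily D F G) (hD : IsOpen D)
    (hF : ∀ x ∈ D, ContDiffAt ℝ ((n + 1 : ℕ) : WithTop ℕ∞)
      (fun p : ℝ × EuclideanSpace ℝ (Fin d) => F p.1 p.2) (0, x))
    (hF0 : ∀ x ∈ D, F 0 x = x) {x} (hx : x ∈ D) :
    ContDiffAt ℝ ((n + 1 : ℕ) : WithTop ℕ∞)
        (fun p : ℝ × EuclideanSpace ℝ (Fin d) => G p.1 p.2) (0, x) ∧ G 0 x = x ∧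
      (∀ᶠ p in 𝓝 ((0 : ℝ), x), F p.1 (G p.1 p.2) = p.2) ∧
      ∀ᶠ p in 𝓝 ((0 : ℝ), x), G p.1 (F p.1 p.2) = p.2 := by
  obtain ⟨U, hU, hDU, hc, hGU⟩ := hG
  have hGx : G 0 x = x := by
    have h := hGU _ (hDU x hx)
    simpa [hF0 _ h.1] using h.2
  have hFG : ∀ᶠ p in 𝓝 ((0 : ℝ), x), F p.1 (G p.1 p.2) = p.2 := by
    filter_upwards [hU.mem_nhds (hDU x hx)] with p hp using (hGU p hp).2
  have := contDiffAt_of_rightInverse (hF x hx)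
    (by filter_upwards [hD.mem_nhds hx] with y hy using hF0 y hy)
    (hc.continuousAt (hU.mem_nhds (hDU x hx))) hGx hFG
  exact ⟨this.1, hGx, hFG, this.2⟩

end InverseFamily

/-! ### Integer iterates near ε = 0 -/

section Iterates

variable {E : Type*} [NormedAddCommGroup E] [NormedSpace ℝ E]
  {F G : ℝ → E → E} {x : E}

lemma contDiffAt_iterate {r : WithTop ℕ∞}
    (hF : ContDiffAt ℝ r (fun p : ℝ × E => F p.1 p.2) (0, x)) (hx : F 0 x = x) (k : ℕ) :
    ContDiffAt ℝ r (fun p : ℝ × E => (F p.1)^[k] p.2) (0, x) := by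
  induction k with
  | zero => exact contDiffAt_snd
  | succ k ih =>
    simp only [Function.iterate_succ_apply]
    exact contDiffAt_comp_fst_prodMk ih hF hx

lemma tendsto_fst_iterate {E : Type*} [TopologicalSpace E] {F : ℝ → E → E} {x : E}
    (hF : ContinuousAt (fun p : ℝ × E => F p.1 p.2) (0, x))
    (hx : F 0 x = x) (k : ℕ) :
    Tendsto (fun p : ℝ × E => (p.1, (F p.1)^[k] p.2)) (𝓝 (0, x)) (𝓝 (0, x)) := by
  induction k with
  | zero => exact tendsto_id
  | succ k ih =>
    simp only [Function.iterate_succ_apply]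
    exact ih.comp (tendsto_fst_prodMk hF hx)

lemma eventually_iterate_iterate {E : Type*} [TopologicalSpace E] {F G : ℝ → E → E} {x : E}
    (hF : ContinuousAt (fun p : ℝ × E => F p.1 p.2) (0, x))
    (hx : F 0 x = x) (h : ∀ᶠ p in 𝓝 ((0 : ℝ), x), G p.1 (F p.1 p.2) = p.2) (k : ℕ) :
    ∀ᶠ p in 𝓝 ((0 : ℝ), x), (G p.1)^[k] ((F p.1)^[k] p.2) = p.2 := by
  induction k with
  | zero => simp
  | succ k ih =>
    filter_upwards [ih, (tendsto_fst_iterate hF hx k).eventually h] with p h1 h2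
    rw [Function.iterate_succ_apply' (F p.1), Function.iterate_succ_apply]
    rw [h2, h1]

lemma contDiffAt_intIterate {r : WithTop ℕ∞}
    (hF : ContDiffAt ℝ r (fun p : ℝ × E => F p.1 p.2) (0, x)) (hFx : F 0 x = x)
    (hG : ContDiffAt ℝ r (fun p : ℝ × E => G p.1 p.2) (0, x)) (hGx : G 0 x = x) (k : ℤ) :
    ContDiffAt ℝ r (fun p : ℝ × E => intIterate (F p.1) (G p.1) k p.2) (0, x) := by
  cases k with
  | ofNat k => exact contDiffAt_iterate hF hFx k
  | negSucc k => exact contDiffAt_iterate hG hGx (k + 1)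

lemma intIterate_fixed {α : Type*} {F G : α → α} {x : α} (hF : F x = x) (hG : G x = x) (k : ℤ) :
    intIterate F G k x = x := by
  cases k with
  | ofNat k => exact Function.iterate_fixed hF k
  | negSucc k => exact Function.iterate_fixed hG (k + 1)

section

variable {E : Type*} [TopologicalSpace E] {F G : ℝ → E → E} {x : E}

lemma eventually_intIterate_iterate
    (hF : ContinuousAt (fun p : ℝ × E => F p.1 p.2) (0, x)) (hFx : F 0 x = x)
    (hGF : ∀ᶠ p in 𝓝 ((0 : ℝ), x), G p.1 (F p.1 p.2) = p.2) {k : ℤ} {b : ℕ} (hk : -(b : ℤ) ≤ k) :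
    ∀ᶠ p in 𝓝 ((0 : ℝ), x),
      intIterate (F p.1) (G p.1) k ((F p.1)^[b] p.2) = (F p.1)^[(k + b).toNat] p.2 := by
  cases k with
  | ofNat k =>
    refine Eventually.of_forall fun p => ?_
    change (F p.1)^[k] _ = _
    rw [← Function.iterate_add_apply]
    congr 1
  | negSucc a =>
    obtain ⟨c, rfl⟩ : ∃ c, b = (a + 1) + c := ⟨b - (a + 1), by omega⟩
    have e : (Int.negSucc a + ((a + 1 + c : ℕ) : ℤ)).toNat = c := by omega
    rw [e]
    filter_upwards [(tendsto_fst_iterate hF hFx c).eventually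
      (eventually_iterate_iterate hF hFx hGF (a + 1))] with p hp
    rw [Function.iterate_add_apply (F p.1) (a + 1) c]
    exact hp

/-- Starting from G^b(x) makes all exponents nonnegative, as Newton's formula requires. -/
lemma eventually_intIterate_eq
    (hF : ContinuousAt (fun p : ℝ × E => F p.1 p.2) (0, x)) (hFx : F 0 x = x)
    (hG : ContinuousAt (fun p : ℝ × E => G p.1 p.2) (0, x)) (hGx : G 0 x = x)
    (hFG : ∀ᶠ p in 𝓝 ((0 : ℝ), x), F p.1 (G p.1 p.2) = p.2)
    (hGF : ∀ᶠ p in 𝓝 ((0 : ℝ), x), G p.1 (F p.1 p.2) = p.2) {k : ℤ} {b : ℕ} (hk : -(b : ℤ) ≤ k) :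
    ∀ᶠ p in 𝓝 ((0 : ℝ), x),
      intIterate (F p.1) (G p.1) k p.2 = (F p.1)^[(k + b).toNat] ((G p.1)^[b] p.2) := by
  filter_upwards [eventually_iterate_iterate hG hGx hFG b, (tendsto_fst_iterate hG hGx b).eventually
    (eventually_intIterate_iterate hF hFx hGF hk)] with p h1 h2
  simp only [h1] at h2
  exact h2

lemma eventually_intIterate_intIterate_eq
    (hF : ContinuousAt (fun p : ℝ × E => F p.1 p.2) (0, x)) (hFx : F 0 x = x)
    (hG : ContinuousAt (fun p : ℝ × E => G p.1 p.2) (0, x)) (hGx : G 0 x = x)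
    (hFG : ∀ᶠ p in 𝓝 ((0 : ℝ), x), F p.1 (G p.1 p.2) = p.2)
    (hGF : ∀ᶠ p in 𝓝 ((0 : ℝ), x), G p.1 (F p.1 p.2) = p.2) {k i : ℤ} {a b : ℕ}
    (hk : -(a : ℤ) ≤ k) (hi : -(b : ℤ) ≤ i) :
    ∀ᶠ p in 𝓝 ((0 : ℝ), x),
      intIterate (F p.1) (G p.1) k (intIterate (F p.1) (G p.1) i p.2) =
        (F p.1)^[(k + i + (a + b : ℕ)).toNat] ((G p.1)^[a + b] p.2) := by
  have h1 : -((a + b : ℕ) : ℤ) ≤ i := by omega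
  have h2 : -((i + (a + b : ℕ)).toNat : ℤ) ≤ k := by omega
  have e : (k + ((i + (a + b : ℕ)).toNat : ℤ)).toNat = (k + i + (a + b : ℕ)).toNat := by omega
  filter_upwards [eventually_intIterate_eq hF hFx hG hGx hFG hGF h1,
    (tendsto_fst_iterate hG hGx (a + b)).eventually
      (eventually_intIterate_iterate hF hFx hGF h2)] with p hp1 hp2
  rw [hp1, hp2, e]

end

end Iterates

/-! ### Lagrange interpolation at consecutive integers -/

section Lagrange

open Polynomial

/-- The nodes `-n₀, …, m - n₀`. -/
noncomputable abbrev nodes (n₀ m : ℕ) : Finset ℤ := Finset.Icc (-(n₀ : ℤ)) ((m : ℤ) - n₀)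

lemma card_nodes (n₀ m : ℕ) : (nodes n₀ m).card = m + 1 := by
  simp only [nodes, Int.card_Icc]
  omega

lemma injOn_intCast (s : Set ℤ) : Set.InjOn (fun j : ℤ => (j : ℝ)) s :=
  fun _ _ _ _ h => Int.cast_injective h

lemma eq_sum_basis {n₀ m : ℕ} {P : ℝ[X]} (hP : P.natDegree ≤ m) :
    P = ∑ k ∈ nodes n₀ m, C (P.eval (k : ℝ)) *
      Lagrange.basis (nodes n₀ m) (fun j : ℤ => (j : ℝ)) k := by
  have h := Lagrange.eq_interpolate (s := nodes n₀ m) (v := fun j : ℤ => (j : ℝ)) (f := P)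
    (injOn_intCast _) (by
      rw [card_nodes]
      exact lt_of_le_of_lt degree_le_natDegree (by exact_mod_cast Nat.lt_succ_of_le hP))
  rw [Lagrange.interpolate_apply] at h
  exact h

/-- Interpolation reproduces degree ≤ m, so the weights compute the derivative at 0 exactly;
translating `P` gives it at any `a`. -/
lemma sum_weight_mul_eval {n₀ m : ℕ} {P : ℝ[X]} (hP : P.natDegree ≤ m) (a : ℝ) :
    ∑ k ∈ nodes n₀ m, weight n₀ m k * P.eval (k + a) = (derivative P).eval a := by
  have hdeg : (P.comp (X + C a)).natDegree ≤ m := by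
    rw [natDegree_comp, natDegree_X_add_C, mul_one]
    exact hP
  have h := congrArg (fun Q => (derivative Q).eval 0) (eq_sum_basis (n₀ := n₀) hdeg)
  simp only [derivative_sum, derivative_C_mul, eval_finsetSum, derivative_comp,
    eval_mul, eval_comp, eval_add, eval_X, eval_C, zero_add, derivative_add, derivative_X,
    derivative_C, add_zero, one_mul] at h
  rw [h]
  exact Finset.sum_congr rfl fun k _ => mul_comm _ _

lemma sum_basis_mul_eval {n₀ m : ℕ} {P : ℝ[X]} (hP : P.natDegree ≤ m) (t : ℝ) :
    ∑ k ∈ nodes n₀ m, (Lagrange.basis (nodes n₀ m) (fun j : ℤ => (j : ℝ)) k).eval t *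
      P.eval (k : ℝ) = P.eval t := by
  have h := congrArg (fun Q => Q.eval t) (eq_sum_basis (n₀ := n₀) hP)
  simp only [eval_finsetSum, eval_C_mul] at h
  rw [h]
  exact Finset.sum_congr rfl fun k _ => mul_comm _ _

/-- The polynomial `t ↦ (t + b choose j)`. -/
noncomputable def shiftedChoose (b j : ℕ) : ℝ[X] :=
  C ((j.factorial : ℝ)⁻¹) * (descPochhammer ℝ j).comp (X + C (b : ℝ))

lemma natDegree_shiftedChoose_le (b j : ℕ) : (shiftedChoose b j).natDegree ≤ j := by
  refine (natDegree_C_mul_le _ _).trans ?_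
  rw [natDegree_comp, natDegree_X_add_C, mul_one, descPochhammer_natDegree]

lemma eval_shiftedChoose (b j : ℕ) {k : ℤ} (hk : -(b : ℤ) ≤ k) :
    (shiftedChoose b j).eval (k : ℝ) = ((k + b).toNat.choose j : ℝ) := by
  have e : (k : ℝ) + b = ((k + b).toNat : ℝ) := by
    have : (((k + b).toNat : ℤ) : ℝ) = ((k + b : ℤ) : ℝ) := by
      rw [Int.toNat_of_nonneg (by omega)]
    push_cast at this
    exact this.symm
  rw [shiftedChoose, eval_C_mul, eval_comp, eval_add, eval_X, eval_C, e,
    descPochhammer_eval_eq_descFactorial, Nat.descFactorial_eq_factorial_mul_choose]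
  have : (j.factorial : ℝ) ≠ 0 := by positivity
  push_cast
  field_simp

variable {V : Type*} [NormedAddCommGroup V] [NormedSpace ℝ V]

lemma taylorWithinEval_interpolate {n₀ m : ℕ} (f : ℝ → V) (s : Set ℝ) (a t : ℝ) :
    taylorWithinEval f m s a t = ∑ k ∈ nodes n₀ m,
      (Lagrange.basis (nodes n₀ m) (fun j : ℤ => (j : ℝ)) k).eval t •
        taylorWithinEval f m s a (k : ℝ) := by
  simp only [taylor_within_apply, Finset.smul_sum, smul_smul]
  rw [Finset.sum_comm]
  refine Finset.sum_congr rfl fun i hi => ?_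
  rw [← Finset.sum_smul]
  congr 1
  have h := sum_basis_mul_eval (n₀ := n₀) (m := m) (P := C ((i.factorial : ℝ)⁻¹) * (X - C a) ^ i)
    ((natDegree_C_mul_le _ _).trans (by
      rw [natDegree_pow, natDegree_X_sub_C, mul_one]
      exact Nat.lt_succ_iff.1 (Finset.mem_range.1 hi))) t
  simp only [eval_C_mul, eval_pow, eval_sub, eval_X, eval_C] at h
  exact h.symm

/-- Interpolation error at the nodes `-n₀, …, m - n₀`. -/
lemma exists_interpolation_bound (n₀ m : ℕ) {a b : ℝ} (hab : a ≤ b)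
    (hn : ∀ k ∈ nodes n₀ m, (k : ℝ) ∈ Icc a b) :
    ∃ M : ℝ, ∀ (f : ℝ → V) (B : ℝ), ContDiffOn ℝ ((m + 1 : ℕ) : WithTop ℕ∞) f (Icc a b) →
      (∀ t ∈ Icc a b, ‖iteratedDerivWithin (m + 1) f (Icc a b) t‖ ≤ B) → ∀ t ∈ Icc a b,
      ‖f t - ∑ k ∈ nodes n₀ m, (Lagrange.basis (nodes n₀ m) (fun j : ℤ => (j : ℝ)) k).eval t •
        f (k : ℝ)‖ ≤ M * B := by
  have hbd : ∀ k : ℤ, ∃ c : ℝ, ∀ t ∈ Icc a b,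
      ‖(Lagrange.basis (nodes n₀ m) (fun j : ℤ => (j : ℝ)) k).eval t‖ ≤ c := fun k =>
    isCompact_Icc.exists_bound_of_continuousOn
      (Lagrange.basis (nodes n₀ m) (fun j : ℤ => (j : ℝ)) k).continuous.continuousOn
  choose c hc using hbd
  set q : ℝ := (b - a) ^ (m + 1) / m.factorial with hq
  have hq0 : 0 ≤ q := by have : 0 ≤ b - a := sub_nonneg.2 hab; positivity
  refine ⟨q + ∑ k ∈ nodes n₀ m, c k * q, fun f B hf hB t ht => ?_⟩
  have hB0 : 0 ≤ B := (norm_nonneg _).trans (hB t ht)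
  have hT : ∀ s ∈ Icc a b, ‖f s - taylorWithinEval f m (Icc a b) a s‖ ≤ q * B := by
    intro s hs
    refine (taylor_mean_remainder_bound hab (by exact_mod_cast hf) hs hB).trans ?_
    rw [hq, div_mul_eq_mul_div, mul_comm]
    have h1 : s - a ≤ b - a := sub_le_sub_right hs.2 a
    have h2 : 0 ≤ s - a := sub_nonneg.2 hs.1
    gcongr
  -- The Taylor polynomial of degree m is reproduced by interpolation, so only its remainder
  -- contributes to the error.
  have e : f t - ∑ k ∈ nodes n₀ m, (Lagrange.basis (nodes n₀ m) (fun j : ℤ => (j : ℝ)) k).eval t •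
        f (k : ℝ) = (f t - taylorWithinEval f m (Icc a b) a t) -
      ∑ k ∈ nodes n₀ m, (Lagrange.basis (nodes n₀ m) (fun j : ℤ => (j : ℝ)) k).eval t •
        (f (k : ℝ) - taylorWithinEval f m (Icc a b) a (k : ℝ)) := by
    simp only [smul_sub, Finset.sum_sub_distrib]
    rw [← taylorWithinEval_interpolate]
    abel
  rw [e, add_mul, Finset.sum_mul]
  refine (norm_sub_le _ _).trans (add_le_add (hT t ht) ((norm_sum_le _ _).trans ?_))
  refine Finset.sum_le_sum fun k hk => ?_
  rw [norm_smul, mul_assoc]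
  exact mul_le_mul (hc k t ht) (hT k (hn k hk)) (norm_nonneg _)
    ((norm_nonneg _).trans (hc k t ht))

end Lagrange

end DiscreteAveraging

namespace DiscreteAveraging

open Filter Topology Asymptotics Set Metric
open scoped NNReal

/-! ### Flows of vector fields that vanish at ε = 0 -/

section Flow

variable {E : Type*} [NormedAddCommGroup E] {X : ℝ → E → E} {x₀ : E} {D : Set E}

/-- Transports a property near (0, x₀) along curves that move only O(ε) from their starting point.
-/
lemma eventually_forall_of_norm_sub_le {P : ℝ × E → Prop} (h : ∀ᶠ p in 𝓝 ((0 : ℝ), x₀), P p)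
    (K : ℝ) : ∀ᶠ p in 𝓝 ((0 : ℝ), x₀), ∀ y, ‖y - p.2‖ ≤ K * |p.1| → P (p.1, y) := by
  obtain ⟨η, hη, h⟩ := Metric.eventually_nhds_iff.1 h
  have t1 : Tendsto (fun p : ℝ × E => |p.1|) (𝓝 (0, x₀)) (𝓝 0) :=
    Continuous.tendsto' (by fun_prop) _ _ (by simp)
  have t2 : Tendsto (fun p : ℝ × E => K * |p.1| + dist p.2 x₀) (𝓝 (0, x₀)) (𝓝 0) :=
    Continuous.tendsto' (by fun_prop) _ _ (by simp)
  filter_upwards [t1.eventually_lt_const hη, t2.eventually_lt_const hη] with p h1 h2 y hy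
  refine h ?_
  rw [Prod.dist_eq]
  refine max_lt (by simpa using h1) ?_
  calc dist y x₀ ≤ dist y p.2 + dist p.2 x₀ := dist_triangle _ _ _
    _ ≤ K * |p.1| + dist p.2 x₀ := by rw [dist_eq_norm y]; gcongr
    _ < η := h2

lemma eventually_abs_fst_le_one (x₀ : E) : ∀ᶠ p in 𝓝 ((0 : ℝ), x₀), |p.1| ≤ 1 := by
  have : Tendsto (fun p : ℝ × E => |p.1|) (𝓝 (0, x₀)) (𝓝 0) :=
    Continuous.tendsto' (by fun_prop) _ _ (by simp)
  exact (this.eventually_lt_const one_pos).mono fun _ => le_of_lt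

lemma eventually_mem_box {r : ℝ} (hr : 0 < r) {P : ℝ → Prop} (hP : ∀ᶠ ε in 𝓝 (0 : ℝ), P ε) :
    ∀ᶠ p in 𝓝 ((0 : ℝ), x₀), P p.1 ∧ p.2 ∈ closedBall x₀ r :=
  ((continuousAt_fst (p := ((0 : ℝ), x₀))).tendsto.eventually hP).and
    ((continuousAt_snd (p := ((0 : ℝ), x₀))).tendsto.eventually (closedBall_mem_nhds x₀ hr))

variable [NormedSpace ℝ E]

lemma hasDerivWithinAt_Ici_of_Icc {f : ℝ → E} {f' : E} {t : ℝ} (ht : t ∈ Ico (0 : ℝ) 1)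
    (h : HasDerivWithinAt f f' (Icc 0 1) t) : HasDerivWithinAt f f' (Ici t) t :=
  h.mono_of_mem_nhdsWithin (mem_of_superset (Icc_mem_nhdsGE ht.2) (Icc_subset_Icc_left ht.1))

/-- A solution which starts in the ball of radius `r` stays in the ball of radius `2 r`, as long as
the vector field is small there. -/
lemma norm_sub_le_of_hasDerivWithinAt {X : E → E} {r b : ℝ} {γ : ℝ → E}
    (hX : ∀ y ∈ closedBall x₀ (2 * r), ‖X y‖ ≤ b) (hbr : b < r) (h0 : γ 0 ∈ closedBall x₀ r)
    (hγ : ∀ t ∈ Icc (0 : ℝ) 1, HasDerivWithinAt γ (X (γ t)) (Icc 0 1) t) :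
    ∀ t ∈ Icc (0 : ℝ) 1, γ t ∈ closedBall x₀ (2 * r) ∧ ‖γ t - γ 0‖ ≤ b := by
  have hr : 0 ≤ r := (dist_nonneg).trans h0
  have hball : ∀ t ∈ Icc (0 : ℝ) 1, ‖γ t - γ 0‖ ≤ r * t → γ t ∈ closedBall x₀ (2 * r) := by
    intro t ht h
    have h0' : dist (γ 0) x₀ ≤ r := h0
    have : dist (γ t) (γ 0) ≤ r * t := by rwa [dist_eq_norm]
    have h2 : r * t ≤ r := mul_le_of_le_one_right hr ht.2
    rw [mem_closedBall]
    linarith [dist_triangle (γ t) (γ 0) x₀]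
  -- Barrier argument: wherever the curve touches the bound r t it is in the ball of radius 2r,
  -- where its speed is below r.
  have key : ∀ t ∈ Icc (0 : ℝ) 1, ‖γ t - γ 0‖ ≤ r * t := by
    refine image_norm_le_of_norm_deriv_right_lt_deriv_boundary (f := fun t => γ t - γ 0)
      (f' := fun t => X (γ t)) (B := fun t => r * t) (B' := fun _ => r) ?_ ?_ (by simp) ?_ ?_
    · exact fun t ht => ((hγ t ht).continuousWithinAt).sub continuousWithinAt_const
    · exact fun t ht =>
        (hasDerivWithinAt_Ici_of_Icc ht (hγ t (Ico_subset_Icc_self ht))).sub_const _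
    · intro t
      simpa using (hasDerivAt_id t).const_mul r
    · intro t ht h
      exact (hX _ (hball t (Ico_subset_Icc_self ht) h.le)).trans_lt hbr
  intro t ht
  refine ⟨hball t ht (key t ht), ?_⟩
  have hb : 0 ≤ b := (norm_nonneg _).trans (hX _ (hball t ht (key t ht)))
  have := (convex_Icc (0 : ℝ) 1).norm_image_sub_le_of_norm_hasDerivWithin_le (f := γ)
    (f' := fun t => X (γ t)) hγ (fun s hs => hX _ (hball s hs (key s hs)))
    (left_mem_Icc.2 zero_le_one) ht
  refine this.trans ?_
  rw [sub_zero, Real.norm_eq_abs, abs_of_nonneg ht.1]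
  exact mul_le_of_le_one_right hb ht.2

/-- A joint Lipschitz constant in (ε, y) does double duty: as X_0 = 0, it also bounds the speed by
K|ε|. -/
lemma exists_flow_box (hD : D ∈ 𝓝 x₀)
    (hX : ContDiffAt ℝ 1 (fun p : ℝ × E => X p.1 p.2) (0, x₀)) (h0 : ∀ᶠ y in 𝓝 x₀, X 0 y = 0) :
    ∃ r > 0, ∃ K : ℝ≥0, closedBall x₀ (2 * r) ⊆ D ∧ ∀ᶠ ε in 𝓝 (0 : ℝ),
      LipschitzOnWith K (X ε) (closedBall x₀ (2 * r)) ∧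
      (∀ y ∈ closedBall x₀ (2 * r), ‖X ε y‖ ≤ K * |ε|) ∧ K * |ε| < r := by
  obtain ⟨K, s, hs, hK⟩ := hX.exists_lipschitzOnWith
  have hty : Tendsto (fun p : ℝ × E => p.2) (𝓝 (0, x₀)) (𝓝 x₀) := continuousAt_snd
  obtain ⟨ρ, hρ, hsub⟩ := Metric.nhds_basis_closedBall.mem_iff.1
    (inter_mem hs (inter_mem (hty hD) (hty h0)))
  have hmem : ∀ ε : ℝ, |ε| ≤ ρ → ∀ y ∈ closedBall x₀ ρ, (ε, y) ∈ s ∧ y ∈ D ∧ X 0 y = 0 := by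
    intro ε hε y hy
    exact hsub (by rw [mem_closedBall, Prod.dist_eq]; exact max_le (by simpa using hε) hy)
  have e : 2 * (ρ / 2) = ρ := by ring
  refine ⟨ρ / 2, by positivity, K, ?_⟩
  rw [e]
  refine ⟨fun y hy => (hmem 0 (by simpa using hρ.le) y hy).2.1, ?_⟩
  have t1 : Tendsto (fun ε : ℝ => |ε|) (𝓝 0) (𝓝 0) := Continuous.tendsto' (by fun_prop) _ _ (by simp)
  have t2 : Tendsto (fun ε : ℝ => K * |ε|) (𝓝 0) (𝓝 0) :=
    Continuous.tendsto' (by fun_prop) _ _ (by simp)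
  filter_upwards [t1.eventually_lt_const hρ, t2.eventually_lt_const (half_pos hρ)] with ε h1 h2
  refine ⟨?_, fun y hy => ?_, h2⟩
  · refine LipschitzOnWith.of_dist_le_mul fun y hy z hz => ?_
    have := hK.dist_le_mul (ε, y) (hmem ε h1.le y hy).1 (ε, z) (hmem ε h1.le z hz).1
    simpa [Prod.dist_eq] using this
  · have := hK.dist_le_mul (ε, y) (hmem ε h1.le y hy).1 (0, y)
      (hmem 0 (by simpa using hρ.le) y hy).1
    simpa [Prod.dist_eq, (hmem ε h1.le y hy).2.2] using this

/-- The speed is O(ε), so for small ε Picard–Lindelöf reaches time 1 inside a fixed ball. -/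
lemma exists_flow_curve [CompleteSpace E] (hD : D ∈ 𝓝 x₀)
    (hX : ContDiffAt ℝ 1 (fun p : ℝ × E => X p.1 p.2) (0, x₀)) (h0 : ∀ᶠ y in 𝓝 x₀, X 0 y = 0) :
    ∃ γ : ℝ × E → ℝ → E, ∃ K : ℝ, ∀ᶠ p in 𝓝 ((0 : ℝ), x₀), γ p 0 = p.2 ∧
      ∀ t ∈ Icc (0 : ℝ) 1, γ p t ∈ D ∧ HasDerivWithinAt (γ p) (X p.1 (γ p t)) (Icc 0 1) t ∧
        ‖γ p t - p.2‖ ≤ K * |p.1| := by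
  obtain ⟨r, hr, K, hrD, hbox⟩ := exists_flow_box hD hX h0
  have hex : ∀ p : ℝ × E, ∃ γ : ℝ → E, (LipschitzOnWith K (X p.1) (closedBall x₀ (2 * r)) ∧
      (∀ y ∈ closedBall x₀ (2 * r), ‖X p.1 y‖ ≤ K * |p.1|) ∧ K * |p.1| < r) ∧
      p.2 ∈ closedBall x₀ r → γ 0 = p.2 ∧
      ∀ t ∈ Icc (0 : ℝ) 1, HasDerivWithinAt γ (X p.1 (γ t)) (Icc 0 1) t := by
    intro p
    by_cases h : (LipschitzOnWith K (X p.1) (closedBall x₀ (2 * r)) ∧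
      (∀ y ∈ closedBall x₀ (2 * r), ‖X p.1 y‖ ≤ K * |p.1|) ∧ K * |p.1| < r) ∧
      p.2 ∈ closedBall x₀ r
    · obtain ⟨⟨hL, hb, hbr⟩, hp⟩ := h
      have hpl : IsPicardLindelof (fun _ => X p.1) (tmin := 0) (tmax := 1)
          ⟨0, left_mem_Icc.2 zero_le_one⟩ x₀ (⟨2 * r, by positivity⟩ : ℝ≥0) (⟨r, hr.le⟩ : ℝ≥0)
          (⟨K * |p.1|, by positivity⟩ : ℝ≥0) K :=
        IsPicardLindelof.of_time_independent hb hL (by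
          change K * |p.1| * max ((1 : ℝ) - 0) (0 - 0) ≤ 2 * r - r
          rw [sub_zero, sub_self, max_eq_left zero_le_one]
          linarith)
      obtain ⟨γ, hγ0, hγ⟩ := hpl.exists_eq_forall_mem_Icc_hasDerivWithinAt hp
      exact ⟨γ, fun _ => ⟨hγ0, hγ⟩⟩
    · exact ⟨fun _ => 0, fun h' => absurd h' h⟩
  choose γ hγ using hex
  refine ⟨γ, K, ?_⟩
  filter_upwards [eventually_mem_box hr hbox] with p hp
  obtain ⟨h1, h2⟩ := hγ p hp
  refine ⟨h1, fun t ht => ?_⟩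
  have := norm_sub_le_of_hasDerivWithinAt hp.1.2.1 hp.1.2.2 (by rw [h1]; exact hp.2) h2 t ht
  rw [h1] at this
  exact ⟨hrD this.1, h2 t ht, this.2⟩

/-- Solutions compared with approximate solutions. -/
lemma exists_norm_sub_le_of_approx_solution
    (hX : ContDiffAt ℝ 1 (fun p : ℝ × E => X p.1 p.2) (0, x₀)) (h0 : ∀ᶠ y in 𝓝 x₀, X 0 y = 0)
    {η η' : ℝ × E → ℝ → E} {K C : ℝ} {N : ℕ}
    (hη : ∀ᶠ p in 𝓝 ((0 : ℝ), x₀), ‖η p 0 - p.2‖ ≤ C * |p.1| ^ N ∧ ∀ t ∈ Icc (0 : ℝ) 1,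
      HasDerivWithinAt (η p) (η' p t) (Icc 0 1) t ∧ ‖η p t - p.2‖ ≤ K * |p.1| ∧
      ‖η' p t - X p.1 (η p t)‖ ≤ C * |p.1| ^ N) :
    ∃ M : ℝ, ∀ᶠ p in 𝓝 ((0 : ℝ), x₀), ∀ γ : ℝ → E, γ 0 = p.2 →
      (∀ t ∈ Icc (0 : ℝ) 1, HasDerivWithinAt γ (X p.1 (γ t)) (Icc 0 1) t) →
      ‖η p 1 - γ 1‖ ≤ M * C * |p.1| ^ N := by
  obtain ⟨r, hr, L, -, hbox⟩ := exists_flow_box univ_mem hX h0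
  have hty : Tendsto (fun p : ℝ × E => p.2) (𝓝 (0, x₀)) (𝓝 x₀) := continuousAt_snd
  have hcl := eventually_forall_of_norm_sub_le
    (hty.eventually (closedBall_mem_nhds x₀ (show 0 < 2 * r by positivity))) K
  -- Grönwall's bound at time 1 with initial error and defect both C|ε|^N; the rate `L + 1` replaces
  -- `L` to keep it nonzero.
  refine ⟨Real.exp (L + 1) + (Real.exp (L + 1) - 1) / (L + 1), ?_⟩
  filter_upwards [hη, eventually_mem_box hr hbox, hcl] with p h1 h2 h3 γ hγ0 hγ
  obtain ⟨h1a, h1b⟩ := h1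
  have hstay := norm_sub_le_of_hasDerivWithinAt h2.1.2.1 h2.1.2.2 (by rw [hγ0]; exact h2.2) hγ
  have hLip : LipschitzOnWith (L + 1) (X p.1) (closedBall x₀ (2 * r)) :=
    h2.1.1.weaken (by simp)
  have key := dist_le_of_approx_trajectories_ODE_of_mem (v := fun _ => X p.1) (K := L + 1)
    (s := fun _ => closedBall x₀ (2 * r)) (f := η p) (g := γ) (f' := η' p)
    (g' := fun t => X p.1 (γ t)) (a := 0) (b := 1) (εf := C * |p.1| ^ N) (εg := 0)
    (δ := C * |p.1| ^ N) (fun _ _ => hLip) (fun t ht => (h1b t ht).1.continuousWithinAt)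
    (fun t ht => hasDerivWithinAt_Ici_of_Icc ht (h1b t (Ico_subset_Icc_self ht)).1)
    (fun t ht => by rw [dist_eq_norm]; exact (h1b t (Ico_subset_Icc_self ht)).2.2)
    (fun t ht => h3 _ (h1b t (Ico_subset_Icc_self ht)).2.1)
    (fun t ht => (hγ t ht).continuousWithinAt)
    (fun t ht => hasDerivWithinAt_Ici_of_Icc ht (hγ t (Ico_subset_Icc_self ht)))
    (fun t ht => by simp) (fun t ht => (hstay t (Ico_subset_Icc_self ht)).1)
    (by rw [hγ0, dist_eq_norm]; exact h1a) 1 (right_mem_Icc.2 zero_le_one)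
  have hL0 : ((L + 1 : ℝ≥0) : ℝ) ≠ 0 := by positivity
  rw [dist_eq_norm, gronwallBound_of_K_ne_0 hL0] at key
  refine key.trans (le_of_eq ?_)
  push_cast
  simp only [sub_zero, mul_one, add_zero]
  ring

end Flow

/-! ### Comparing F_ε with time-one maps -/

section ApproxByFlow

variable {d : ℕ} {D : Set (EuclideanSpace ℝ (Fin d))}
  {F X Y : ℝ → EuclideanSpace ℝ (Fin d) → EuclideanSpace ℝ (Fin d)} {N : ℕ}

/-- Compactness: local estimates near each (0, x₀) are combined over a finite cover. -/
lemma approxByFlow_of_eventually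
    (h : ∀ x₀ ∈ D, ∃ C : ℝ, ∀ᶠ p in 𝓝 ((0 : ℝ), x₀), (∃! y, IsTimeOneImage D (X p.1) p.2 y) ∧
      ∀ y, IsTimeOneImage D (X p.1) p.2 y → ‖F p.1 p.2 - y‖ ≤ C * |p.1| ^ N) :
    ApproxByFlow D F X N := by
  intro K hK hKD
  refine hK.induction_on (p := fun s => ∃ C δ : ℝ, 0 < δ ∧ ∀ ε : ℝ, |ε| ≤ δ → ∀ x ∈ s,
      (∃! y, IsTimeOneImage D (X ε) x y) ∧
      ∀ y, IsTimeOneImage D (X ε) x y → ‖F ε x - y‖ ≤ C * |ε| ^ N) ?_ ?_ ?_ ?_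
  · exact ⟨0, 1, one_pos, by simp⟩
  · rintro s t hst ⟨C, δ, hδ, h⟩
    exact ⟨C, δ, hδ, fun ε hε x hx => h ε hε x (hst hx)⟩
  · rintro s t ⟨C, δ, hδ, h⟩ ⟨C', δ', hδ', h'⟩
    refine ⟨max C C', min δ δ', lt_min hδ hδ', fun ε hε x hx => ?_⟩
    rcases hx with hx | hx
    · refine ⟨(h ε (hε.trans (min_le_left _ _)) x hx).1, fun y hy => ?_⟩
      refine ((h ε (hε.trans (min_le_left _ _)) x hx).2 y hy).trans ?_
      gcongr
      exact le_max_left _ _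
    · refine ⟨(h' ε (hε.trans (min_le_right _ _)) x hx).1, fun y hy => ?_⟩
      refine ((h' ε (hε.trans (min_le_right _ _)) x hx).2 y hy).trans ?_
      gcongr
      exact le_max_right _ _
  · intro x hx
    obtain ⟨C, hC⟩ := h x (hKD hx)
    obtain ⟨η, hη, h⟩ := Metric.eventually_nhds_iff.1 hC
    refine ⟨ball x η, mem_nhdsWithin_of_mem_nhds (ball_mem_nhds x hη), C, η / 2, half_pos hη,
      fun ε hε y hy => h (y := (ε, y)) ?_⟩
    rw [Prod.dist_eq]
    exact max_lt (by simpa using hε.trans_lt (half_lt_self hη)) hy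

lemma ApproxByFlow.eventually (h : ApproxByFlow D F X N) (hD : IsOpen D)
    {x₀ : EuclideanSpace ℝ (Fin d)} (hx₀ : x₀ ∈ D) :
    ∃ C : ℝ, ∀ᶠ p in 𝓝 ((0 : ℝ), x₀),
      ∀ y, IsTimeOneImage D (X p.1) p.2 y → ‖F p.1 p.2 - y‖ ≤ C * |p.1| ^ N := by
  obtain ⟨r, hr, hrD⟩ := Metric.nhds_basis_closedBall.mem_iff.1 (hD.mem_nhds hx₀)
  obtain ⟨C, δ, hδ, h⟩ := h _ (isCompact_closedBall x₀ r) hrD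
  have hP : ∀ᶠ ε : ℝ in 𝓝 0, |ε| ≤ δ := by
    filter_upwards [closedBall_mem_nhds (0 : ℝ) hδ] with ε hε
    simpa using hε
  exact ⟨C, (eventually_mem_box hr hP).mono fun p hp => (h p.1 hp.1 p.2 hp.2).2⟩

lemma eventually_existsUnique_isTimeOneImage {x₀ : EuclideanSpace ℝ (Fin d)} (hD : D ∈ 𝓝 x₀)
    (hX : ContDiffAt ℝ 1 (fun p : ℝ × EuclideanSpace ℝ (Fin d) => X p.1 p.2) (0, x₀))
    (h0 : ∀ᶠ y in 𝓝 x₀, X 0 y = 0) :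
    ∀ᶠ p in 𝓝 ((0 : ℝ), x₀), ∃! y, IsTimeOneImage D (X p.1) p.2 y := by
  obtain ⟨γ, K, hγ⟩ := exists_flow_curve hD hX h0
  -- With defect `C = 0` the comparison estimate becomes uniqueness.
  obtain ⟨M, hM⟩ := exists_norm_sub_le_of_approx_solution hX h0 (η := γ)
    (η' := fun p t => X p.1 (γ p t)) (K := K) (C := 0) (N := 0) (by
      filter_upwards [hγ] with p hp
      refine ⟨by simp [hp.1], fun t ht => ⟨(hp.2 t ht).2.1, (hp.2 t ht).2.2, by simp⟩⟩)
  filter_upwards [hγ, hM] with p h1 h2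
  refine ⟨γ p 1, ⟨γ p, h1.1, rfl, fun t ht => ⟨(h1.2 t ht).1, (h1.2 t ht).2.1⟩⟩, ?_⟩
  rintro y ⟨σ, s0, s1, hσ⟩
  have := h2 σ s0 fun t ht => (hσ t ht).2
  rw [mul_zero, zero_mul, norm_le_zero_iff, sub_eq_zero, s1] at this
  exact this.symm

/-- An approximate solution which ends near `F_ε (x)`. -/
lemma approxByFlow_of_approx_solution (hD : IsOpen D)
    (hX : ∀ x₀ ∈ D, ContDiffAt ℝ 1 (fun p : ℝ × EuclideanSpace ℝ (Fin d) => X p.1 p.2) (0, x₀))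
    (h0 : ∀ x ∈ D, X 0 x = 0)
    (hη : ∀ x₀ ∈ D, ∃ (η η' : ℝ × EuclideanSpace ℝ (Fin d) → ℝ → EuclideanSpace ℝ (Fin d))
      (K C : ℝ), ∀ᶠ p in 𝓝 ((0 : ℝ), x₀), ‖η p 0 - p.2‖ ≤ C * |p.1| ^ N ∧
        ‖F p.1 p.2 - η p 1‖ ≤ C * |p.1| ^ N ∧ ∀ t ∈ Icc (0 : ℝ) 1,
        HasDerivWithinAt (η p) (η' p t) (Icc 0 1) t ∧ ‖η p t - p.2‖ ≤ K * |p.1| ∧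
        ‖η' p t - X p.1 (η p t)‖ ≤ C * |p.1| ^ N) :
    ApproxByFlow D F X N := by
  refine approxByFlow_of_eventually fun x₀ hx₀ => ?_
  have h0' : ∀ᶠ y in 𝓝 x₀, X 0 y = 0 := by
    filter_upwards [hD.mem_nhds hx₀] with y hy using h0 y hy
  obtain ⟨η, η', K, C, h⟩ := hη x₀ hx₀
  obtain ⟨M, hM⟩ := exists_norm_sub_le_of_approx_solution (hX x₀ hx₀) h0' (η := η) (η' := η')
    (K := K) (C := C) (N := N) (h.mono fun p hp => ⟨hp.1, hp.2.2⟩)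
  refine ⟨C + M * C, ?_⟩
  filter_upwards [h, hM,
    eventually_existsUnique_isTimeOneImage (hD.mem_nhds hx₀) (hX x₀ hx₀) h0'] with p h1 h2 h3
  refine ⟨h3, fun y hy => ?_⟩
  obtain ⟨γ, g0, g1, hγ⟩ := hy
  rw [← g1, add_mul]
  exact (norm_sub_le_norm_sub_add_norm_sub _ (η p 1) _).trans
    (add_le_add h1.2.1 (h2 γ g0 fun t ht => (hγ t ht).2))

/-- A solution for `X` is an approximate solution for `Y`, with defect X − Y. -/
lemma ApproxByFlow.congr (h : ApproxByFlow D F X N) (hD : IsOpen D)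
    (hX : ∀ x₀ ∈ D, ContDiffAt ℝ 1 (fun p : ℝ × EuclideanSpace ℝ (Fin d) => X p.1 p.2) (0, x₀))
    (hX0 : ∀ x ∈ D, X 0 x = 0)
    (hY : ∀ x₀ ∈ D, ContDiffAt ℝ 1 (fun p : ℝ × EuclideanSpace ℝ (Fin d) => Y p.1 p.2) (0, x₀))
    (hY0 : ∀ x ∈ D, Y 0 x = 0) {M : ℕ} (hM : M ≤ N)
    (hXY : ∀ x₀ ∈ D, (fun p : ℝ × EuclideanSpace ℝ (Fin d) => X p.1 p.2 - Y p.1 p.2)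
      =O[𝓝 (0, x₀)] fun p => p.1 ^ M) :
    ApproxByFlow D F Y M := by
  refine approxByFlow_of_approx_solution hD hY hY0 fun x₀ hx₀ => ?_
  have hX0' : ∀ᶠ y in 𝓝 x₀, X 0 y = 0 := by
    filter_upwards [hD.mem_nhds hx₀] with y hy using hX0 y hy
  obtain ⟨γ, K, hγ⟩ := exists_flow_curve (hD.mem_nhds hx₀) (hX x₀ hx₀) hX0'
  obtain ⟨C₁, hC₁⟩ := h.eventually hD hx₀
  obtain ⟨C₂, hC₂⟩ := (hXY x₀ hx₀).bound
  refine ⟨γ, fun p t => X p.1 (γ p t), K, |C₁| + |C₂|, ?_⟩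
  filter_upwards [hγ, hC₁, eventually_abs_fst_le_one x₀,
    eventually_forall_of_norm_sub_le hC₂ K] with p h1 h2 h3 h4
  have hpow : 0 ≤ |p.1| ^ M := by positivity
  refine ⟨?_, ?_, fun t ht => ⟨(h1.2 t ht).2.1, (h1.2 t ht).2.2, ?_⟩⟩
  · rw [h1.1, sub_self, norm_zero]
    positivity
  · refine (h2 _ ⟨γ p, h1.1, rfl, fun t ht => ⟨(h1.2 t ht).1, (h1.2 t ht).2.1⟩⟩).trans ?_
    calc C₁ * |p.1| ^ N ≤ |C₁| * |p.1| ^ N := by gcongr; exact le_abs_self _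
      _ ≤ |C₁| * |p.1| ^ M := by
        gcongr ?_ * ?_
        exact pow_le_pow_of_le_one (abs_nonneg _) h3 hM
      _ ≤ (|C₁| + |C₂|) * |p.1| ^ M := by
        gcongr
        exact le_add_of_nonneg_right (abs_nonneg _)
  · refine (h4 _ (h1.2 t ht).2.2).trans ?_
    simp only [norm_pow, Real.norm_eq_abs]
    gcongr
    exact (le_abs_self _).trans (le_add_of_nonneg_left (abs_nonneg _))

end ApproxByFlow

end DiscreteAveraging

namespace DiscreteAveraging

open Filter Topology Asymptotics Set Metric Polynomial

/-! ### Derivatives of polynomial curves with coefficients of size ε^j -/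

section PolynomialCurves

variable {V : Type*} [NormedAddCommGroup V] [NormedSpace ℝ V]

lemma hasDerivAt_sum_eval_smul (s : Finset ℕ) (P : ℕ → ℝ[X]) (v : ℕ → V) (t : ℝ) :
    HasDerivAt (fun t => ∑ j ∈ s, (P j).eval t • v j)
      (∑ j ∈ s, (derivative (P j)).eval t • v j) t :=
  HasDerivAt.fun_sum fun j _ => ((P j).hasDerivAt t).smul_const (v j)

lemma contDiff_sum_eval_smul {r : WithTop ℕ∞} (s : Finset ℕ) (P : ℕ → ℝ[X]) (v : ℕ → V) :
    ContDiff ℝ r (fun t => ∑ j ∈ s, (P j).eval t • v j) :=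
  ContDiff.sum fun j _ => ContDiff.smul
    (by simpa only [coe_aeval_eq_eval] using (P j).contDiff_aeval (𝕜 := ℝ) r) contDiff_const

lemma iteratedDeriv_sum_eval_smul (s : Finset ℕ) (P : ℕ → ℝ[X]) (v : ℕ → V) (i : ℕ) :
    iteratedDeriv i (fun t => ∑ j ∈ s, (P j).eval t • v j) =
      fun t => ∑ j ∈ s, (derivative^[i] (P j)).eval t • v j := by
  induction i generalizing P with
  | zero => simp
  | succ i ih =>
    rw [iteratedDeriv_succ', funext fun t => (hasDerivAt_sum_eval_smul s P v t).deriv, ih]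
    simp only [Function.iterate_succ_apply]

lemma exists_eval_bound (P : ℝ[X]) (a b : ℝ) : ∃ c, 0 ≤ c ∧ ∀ t ∈ Icc a b, |P.eval t| ≤ c := by
  obtain ⟨c, hc⟩ := isCompact_Icc.exists_bound_of_continuousOn (s := Icc a b)
    P.continuous.continuousOn
  exact ⟨|c|, abs_nonneg _, fun t ht => (hc t ht).trans (le_abs_self _)⟩

/-- The derivatives of a polynomial curve whose coefficient of degree `j` is of size `e^j`. -/
lemma exists_norm_iteratedFDerivWithin_le (m : ℕ) {P : ℕ → ℝ[X]} (hP : ∀ j, (P j).natDegree ≤ j)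
    {a b : ℝ} (hab : a < b) (C : ℝ) : ∃ K : ℝ, 0 ≤ K ∧ ∀ (e : ℝ) (v : ℕ → V), 0 ≤ e → e ≤ 1 →
      (∀ j ≤ m, ‖v j‖ ≤ C * e ^ j) → ∀ i, 1 ≤ i → i ≤ m + 1 → ∀ t ∈ Icc a b,
      ‖iteratedFDerivWithin ℝ i (fun t => ∑ j ∈ Finset.range (m + 1), (P j).eval t • v j)
        (Icc a b) t‖ ≤ (K * e) ^ i := by
  choose c hc0 hc using fun i j => exists_eval_bound (derivative^[i] (P j)) a b
  set K : ℝ := 1 + ∑ i ∈ Finset.range (m + 2), ∑ j ∈ Finset.range (m + 1), c i j * |C| with hK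
  have hKi : ∀ i ≤ m + 1, ∑ j ∈ Finset.range (m + 1), c i j * |C| ≤ K := by
    intro i hi
    have := Finset.single_le_sum (f := fun i => ∑ j ∈ Finset.range (m + 1), c i j * |C|)
      (fun i _ => Finset.sum_nonneg fun j _ => mul_nonneg (hc0 i j) (abs_nonneg C))
      (Finset.mem_range.2 (Nat.lt_succ_of_le hi))
    linarith
  -- K ≥ 1 gives K ≤ K^i, so the bounds take the form (K e)^i that the estimate for derivatives of a
  -- composition needs.
  have hK1 : 1 ≤ K := le_add_of_nonneg_right
    (Finset.sum_nonneg fun i _ => Finset.sum_nonneg fun j _ => mul_nonneg (hc0 i j) (abs_nonneg C))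
  refine ⟨K, zero_le_one.trans hK1, fun e v he0 he1 hv i hi1 hi t ht => ?_⟩
  rw [norm_iteratedFDerivWithin_eq_norm_iteratedDerivWithin,
    iteratedDerivWithin_eq_iteratedDeriv (uniqueDiffOn_Icc hab)
      (contDiff_sum_eval_smul _ _ _).contDiffAt ht, iteratedDeriv_sum_eval_smul, mul_pow]
  have hterm : ∀ j ∈ Finset.range (m + 1), ‖(derivative^[i] (P j)).eval t • v j‖ ≤
      c i j * |C| * e ^ i := by
    intro j hj
    have hjm : j ≤ m := Nat.lt_succ_iff.1 (Finset.mem_range.1 hj)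
    -- Terms of degree below i are killed by the i-th derivative; for the others e^j ≤ e^i.
    rcases lt_or_ge j i with hji | hji
    · rw [iterate_derivative_eq_zero ((hP j).trans_lt hji), eval_zero, zero_smul, norm_zero]
      have := hc0 i j
      positivity
    · rw [norm_smul, mul_assoc]
      refine mul_le_mul (hc i j t ht) ((hv j hjm).trans ?_) (norm_nonneg _) (hc0 i j)
      calc C * e ^ j ≤ |C| * e ^ j := by gcongr; exact le_abs_self _
        _ ≤ |C| * e ^ i := by gcongr ?_ * ?_; exact pow_le_pow_of_le_one he0 he1 hji
  refine (norm_sum_le_of_le _ hterm).trans ?_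
  rw [← Finset.sum_mul]
  gcongr
  exact (hKi i hi).trans (le_self_pow₀ hK1 (by omega))

end PolynomialCurves

/-! ### From the nodes to the whole interval -/

section Estimate

variable {E : Type*} [NormedAddCommGroup E] [NormedSpace ℝ E] {x : E}

lemma exists_ball_contDiffOn {V : Type*} [NormedAddCommGroup V] [NormedSpace ℝ V] {r : ℕ}
    {g : E → V} (hg : ContDiffAt ℝ (r : WithTop ℕ∞) g x) :
    ∃ ρ > 0, ∃ C : ℝ, ContDiffOn ℝ (r : WithTop ℕ∞) g (ball x ρ) ∧
      ∀ q ∈ ball x ρ, ∀ i ≤ r, ‖iteratedFDerivWithin ℝ i g (ball x ρ) q‖ ≤ C := by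
  have hbd : ∀ i ∈ Finset.range (r + 1),
      ∀ᶠ q in 𝓝 x, ‖iteratedFDeriv ℝ i g q‖ < ‖iteratedFDeriv ℝ i g x‖ + 1 := by
    intro i hi
    have hi' : i ≤ r := Nat.lt_succ_iff.1 (Finset.mem_range.1 hi)
    have hc : ContinuousAt (iteratedFDeriv ℝ i g) x :=
      (hg.iteratedFDeriv_right (m := 0) (by
        rw [zero_add]; exact_mod_cast hi')).continuousAt
    exact hc.norm.eventually_lt_const (lt_add_one _)
  have hall := (Filter.eventually_all_finset (Finset.range (r + 1))).2 hbd
  obtain ⟨ρ, hρ, h⟩ := Metric.eventually_nhds_iff_ball.1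
    (hall.and (hg.eventually (by simp)))
  refine ⟨ρ, hρ, ∑ i ∈ Finset.range (r + 1), (‖iteratedFDeriv ℝ i g x‖ + 1),
    fun q hq => (h q hq).2.contDiffWithinAt, fun q hq i hi => ?_⟩
  rw [iteratedFDerivWithin_of_isOpen i isOpen_ball hq]
  have hi' := Finset.mem_range.2 (Nat.lt_succ_of_le hi)
  refine ((h q hq).1 i hi').le.trans ?_
  exact Finset.single_le_sum (f := fun i => ‖iteratedFDeriv ℝ i g x‖ + 1)
    (fun i _ => by positivity) hi'

lemma exists_common_bound {α ι V : Type*} [NormedAddCommGroup V] {l : Filter α} (s : Finset ι)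
    {f : ι → α → V} {g : ι → α → ℝ} (h : ∀ i ∈ s, f i =O[l] g i) :
    ∃ C : ℝ, 0 ≤ C ∧ ∀ᶠ p in l, ∀ i ∈ s, ‖f i p‖ ≤ C * ‖g i p‖ := by
  have h' : ∀ i, ∃ c, 0 ≤ c ∧ (i ∈ s → ∀ᶠ p in l, ‖f i p‖ ≤ c * ‖g i p‖) := by
    intro i
    by_cases hi : i ∈ s
    · obtain ⟨c, hc0, hc⟩ := (h i hi).exists_nonneg
      exact ⟨c, hc0, fun _ => hc.bound⟩
    · exact ⟨0, le_rfl, fun h => absurd h hi⟩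
  choose c hc0 hc using h'
  refine ⟨∑ i ∈ s, c i, Finset.sum_nonneg fun i _ => hc0 i, ?_⟩
  filter_upwards [(Filter.eventually_all_finset s).2 hc] with p hp i hi
  refine (hp i hi).trans ?_
  gcongr
  exact Finset.single_le_sum (fun i _ => hc0 i) hi

/-- A polynomial curve `Q` which solves `Q' = X (Q)` up to `O(ε^(m+1))` at the nodes does so
on the whole interval. -/
lemma polynomial_curve_estimate {X : ℝ × E → E} {m n₀ : ℕ}
    (hX : ContDiffAt ℝ ((m + 1 : ℕ) : WithTop ℕ∞) X (0, x))
    {P : ℕ → ℝ[X]} (hP : ∀ j, (P j).natDegree ≤ j) (hP0 : P 0 = 1) {Δ : ℕ → ℝ × E → E}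
    (hΔ : ∀ j ≤ m, Δ j =O[𝓝 (0, x)] fun p => p.1 ^ j)
    (h0 : (fun p : ℝ × E => ∑ j ∈ Finset.range (m + 1), (P j).eval 0 • Δ j p - p.2)
      =O[𝓝 (0, x)] fun p => p.1)
    (hnode : ∀ k ∈ nodes n₀ m, (fun p : ℝ × E =>
      ∑ j ∈ Finset.range (m + 1), (derivative (P j)).eval (k : ℝ) • Δ j p -
        X (p.1, ∑ j ∈ Finset.range (m + 1), (P j).eval (k : ℝ) • Δ j p))
      =O[𝓝 (0, x)] fun p => p.1 ^ (m + 1)) :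
    ∃ K C : ℝ, ∀ᶠ p in 𝓝 ((0 : ℝ), x), ∀ t ∈ Icc (0 : ℝ) 1,
      ‖∑ j ∈ Finset.range (m + 1), (P j).eval t • Δ j p - p.2‖ ≤ K * |p.1| ∧
      ‖∑ j ∈ Finset.range (m + 1), (derivative (P j)).eval t • Δ j p -
        X (p.1, ∑ j ∈ Finset.range (m + 1), (P j).eval t • Δ j p)‖ ≤ C * |p.1| ^ (m + 1) := by
  set a : ℝ := -(n₀ : ℝ) with ha
  -- [a, b] contains the nodes and also [0, 1], which reaches beyond the last node when n₀ = m.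
  set b : ℝ := (m : ℝ) + 1 with hb
  have hab : a < b := by
    have h1 : (0 : ℝ) ≤ n₀ := by positivity
    have h2 : (0 : ℝ) ≤ m := by positivity
    linarith
  have h01 : Icc (0 : ℝ) 1 ⊆ Icc a b := by
    have h1 : (0 : ℝ) ≤ n₀ := by positivity
    have h2 : (0 : ℝ) ≤ m := by positivity
    exact Icc_subset_Icc (by linarith) (by linarith)
  have hnab : ∀ k ∈ nodes n₀ m, (k : ℝ) ∈ Icc a b := by
    intro k hk
    obtain ⟨h1, h2⟩ := Finset.mem_Icc.1 hk
    have h1' : ((-(n₀ : ℤ) : ℤ) : ℝ) ≤ k := by exact_mod_cast h1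
    have h2' : (k : ℝ) ≤ ((m : ℤ) : ℝ) := by exact_mod_cast (by omega : k ≤ m)
    push_cast at h1' h2'
    exact ⟨h1', by linarith⟩
  -- uniform bounds for the coefficients
  obtain ⟨C₁, hC₁0, hC₁⟩ := exists_common_bound (Finset.range (m + 1)) (f := Δ)
    (g := fun j p => p.1 ^ j) (fun j hj => hΔ j (Nat.lt_succ_iff.1 (Finset.mem_range.1 hj)))
  obtain ⟨C₀, hC₀⟩ := h0.bound
  obtain ⟨C₂, hC₂0, hC₂⟩ := exists_common_bound (nodes n₀ m) hnode
  have hsmall := eventually_abs_fst_le_one x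
  -- the curve stays close to its starting point
  choose c hc0 hc using fun j => exists_eval_bound (P j) a b
  have h0ab : (0 : ℝ) ∈ Icc a b := h01 (left_mem_Icc.2 zero_le_one)
  set K : ℝ := C₀ + ∑ j ∈ Finset.range (m + 1), (c j + c j) * C₁ with hKdef
  have hclose : ∀ᶠ p in 𝓝 ((0 : ℝ), x), ∀ t ∈ Icc a b,
      ‖∑ j ∈ Finset.range (m + 1), (P j).eval t • Δ j p - p.2‖ ≤ K * |p.1| := by
    filter_upwards [hC₁, hC₀, hsmall] with p h1 h2 h3 t ht
    have e : ∑ j ∈ Finset.range (m + 1), (P j).eval t • Δ j p - p.2 =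
        (∑ j ∈ Finset.range (m + 1), (P j).eval 0 • Δ j p - p.2) +
        ∑ j ∈ Finset.range (m + 1), ((P j).eval t - (P j).eval 0) • Δ j p := by
      simp only [sub_smul, Finset.sum_sub_distrib]
      abel
    rw [e, hKdef, add_mul, Finset.sum_mul]
    refine (norm_add_le _ _).trans (add_le_add h2 (norm_sum_le_of_le _ fun j hj => ?_))
    rcases Nat.eq_zero_or_pos j with rfl | hj0
    · simp only [hP0, eval_one, sub_self, zero_smul, norm_zero]
      have := hc0 0
      positivity
    · rw [norm_smul, mul_assoc]
      refine mul_le_mul ?_ ((h1 j hj).trans ?_) (norm_nonneg _) (add_nonneg (hc0 j) (hc0 j))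
      · exact (abs_sub _ _).trans (add_le_add (hc j t ht) (hc j 0 h0ab))
      · rw [norm_pow, Real.norm_eq_abs]
        gcongr
        exact pow_le_of_le_one (abs_nonneg _) h3 (by omega)
  -- the composition of the vector field with the curve
  obtain ⟨ρ, hρ, C₃, hXρ, hC₃⟩ := exists_ball_contDiffOn hX
  obtain ⟨K', hK'0, hK'⟩ := exists_norm_iteratedFDerivWithin_le (V := ℝ × E) m hP hab (C₁ + 1)
  obtain ⟨M, hM⟩ := exists_interpolation_bound (V := E) n₀ m hab.le hnab
  choose c' hc'0 hc' using fun k : ℤ =>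
    exists_eval_bound (Lagrange.basis (nodes n₀ m) (fun j : ℤ => (j : ℝ)) k) a b
  refine ⟨K, (∑ k ∈ nodes n₀ m, c' k * C₂) + M * ((m + 1).factorial * C₃ * K' ^ (m + 1)), ?_⟩
  filter_upwards [hclose, hC₁, hC₂, hsmall,
    eventually_forall_of_norm_sub_le (ball_mem_nhds ((0 : ℝ), x) hρ) K] with p h1 h2 h3 h4 h5 t ht
  refine ⟨h1 t (h01 ht), ?_⟩
  -- ε is adjoined to the coefficient of degree 0; as `P 0 = 1`, the pair (ε, Q(t)) is again a
  -- polynomial curve.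
  set v : ℕ → ℝ × E := fun j => (if j = 0 then p.1 else 0, Δ j p) with hv
  have hcurve : ∀ t, (p.1, ∑ j ∈ Finset.range (m + 1), (P j).eval t • Δ j p) =
      ∑ j ∈ Finset.range (m + 1), (P j).eval t • v j := by
    intro t
    refine Prod.ext ?_ ?_
    · rw [Prod.fst_sum, Finset.sum_range_succ']
      simp [hv, hP0]
    · rw [Prod.snd_sum]
      rfl
  have hvb : ∀ j ≤ m, ‖v j‖ ≤ (C₁ + 1) * |p.1| ^ j := by
    intro j hj
    have hΔj := h2 j (Finset.mem_range.2 (Nat.lt_succ_of_le hj))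
    rw [norm_pow, Real.norm_eq_abs] at hΔj
    rw [Prod.norm_def]
    refine max_le ?_ (hΔj.trans (by gcongr; linarith))
    by_cases hj0 : j = 0
    · simp only [hv, hj0, if_true, pow_zero, mul_one, Real.norm_eq_abs]
      linarith
    · simp only [hv, hj0, if_false, norm_zero]
      positivity
  have hcomp := hM (X ∘ fun t => ∑ j ∈ Finset.range (m + 1), (P j).eval t • v j)
    ((m + 1).factorial * C₃ * (K' * |p.1|) ^ (m + 1)) ?_ ?_ t (h01 ht)
  -- Q' has degree ≤ m, so it equals its interpolant; it is compared with X(Q) through the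
  -- interpolant `S` of X(Q).
  · have hQ' : ∑ j ∈ Finset.range (m + 1), (derivative (P j)).eval t • Δ j p =
        ∑ k ∈ nodes n₀ m, (Lagrange.basis (nodes n₀ m) (fun j : ℤ => (j : ℝ)) k).eval t •
          ∑ j ∈ Finset.range (m + 1), (derivative (P j)).eval (k : ℝ) • Δ j p := by
      simp only [Finset.smul_sum, smul_smul]
      rw [Finset.sum_comm]
      refine Finset.sum_congr rfl fun j hj => ?_
      rw [← Finset.sum_smul, sum_basis_mul_eval]
      exact (natDegree_derivative_le _).trans ((Nat.sub_le _ _).trans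
        ((hP j).trans (Nat.lt_succ_iff.1 (Finset.mem_range.1 hj))))
    simp only [Function.comp, ← hcurve] at hcomp
    rw [hQ', add_mul, Finset.sum_mul]
    set S := ∑ k ∈ nodes n₀ m, (Lagrange.basis (nodes n₀ m) (fun j : ℤ => (j : ℝ)) k).eval t •
      X (p.1, ∑ j ∈ Finset.range (m + 1), (P j).eval (k : ℝ) • Δ j p) with hS
    rw [norm_sub_rev] at hcomp
    refine (norm_sub_le_norm_sub_add_norm_sub _ S _).trans (add_le_add ?_ (hcomp.trans_eq ?_))
    · rw [hS, ← Finset.sum_sub_distrib]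
      refine norm_sum_le_of_le _ fun k hk => ?_
      rw [← smul_sub, norm_smul, mul_assoc]
      refine mul_le_mul (hc' k t (h01 ht)) ?_ (norm_nonneg _) (hc'0 k)
      simpa using h3 k hk
    · rw [mul_pow]
      ring
  · exact hXρ.comp (contDiff_sum_eval_smul _ _ _).contDiffOn
      fun s hs => by rw [← hcurve]; exact h5 _ (h1 s hs)
  · intro s hs
    rw [← norm_iteratedFDerivWithin_eq_norm_iteratedDerivWithin]
    have hmaps : MapsTo (fun t => ∑ j ∈ Finset.range (m + 1), (P j).eval t • v j) (Icc a b)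
        (ball (0, x) ρ) := fun s hs => by
      simp only [← hcurve]
      exact h5 _ (h1 s hs)
    exact norm_iteratedFDerivWithin_comp_le hXρ (contDiff_sum_eval_smul _ _ _).contDiffOn le_rfl
      isOpen_ball.uniqueDiffOn (uniqueDiffOn_Icc hab) hmaps hs
      (fun i hi => hC₃ _ (hmaps hs) i hi)
      (fun i hi1 hi => hK' |p.1| v (abs_nonneg _) h4 hvb i hi1 hi s hs)

end Estimate

/-! ### The interpolating vector field and its approximate solution -/

section InterpField

variable {d n m n₀ : ℕ} {x : EuclideanSpace ℝ (Fin d)}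
  {F G : ℝ → EuclideanSpace ℝ (Fin d) → EuclideanSpace ℝ (Fin d)}

lemma contDiffAt_interpField {r : WithTop ℕ∞} (n₀ m : ℕ)
    (hF : ContDiffAt ℝ r (fun p : ℝ × EuclideanSpace ℝ (Fin d) => F p.1 p.2) (0, x))
    (hFx : F 0 x = x)
    (hG : ContDiffAt ℝ r (fun p : ℝ × EuclideanSpace ℝ (Fin d) => G p.1 p.2) (0, x))
    (hGx : G 0 x = x) :
    ContDiffAt ℝ r
      (fun p : ℝ × EuclideanSpace ℝ (Fin d) => interpField n₀ m (F p.1) (G p.1) p.2) (0, x) :=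
  ContDiffAt.sum fun k _ => ContDiffAt.const_smul (weight n₀ m k)
    (contDiffAt_intIterate hF hFx hG hGx k)

/-- At a common fixed point all iterates agree, and the weights sum to the derivative of the
constant 1. -/
lemma interpField_eq_zero (n₀ m : ℕ) {F G : EuclideanSpace ℝ (Fin d) → EuclideanSpace ℝ (Fin d)}
    (hF : F x = x) (hG : G x = x) : interpField n₀ m F G x = 0 := by
  have h := sum_weight_mul_eval (n₀ := n₀) (m := m) (P := 1) (by simp) 0
  simp only [eval_one, mul_one, derivative_one, eval_zero] at h
  simp only [interpField, intIterate_fixed hF hG, ← Finset.sum_smul]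
  rw [h, zero_smul]

lemma isBigO_pow_of_le {E : Type*} [NormedAddCommGroup E] {x : E} {i j : ℕ} (h : i ≤ j) :
    (fun p : ℝ × E => p.1 ^ j) =O[𝓝 (0, x)] fun p => p.1 ^ i := by
  refine IsBigO.of_bound 1 ?_
  filter_upwards [eventually_abs_fst_le_one x] with p hp
  rw [one_mul, norm_pow, norm_pow, Real.norm_eq_abs]
  exact pow_le_pow_of_le_one (abs_nonneg _) hp h

/-- The interpolating polynomial in the time variable is, up to `O(ε^(m+1))`, a solution of the
differential equation defined by the interpolating vector field. -/
lemma exists_interpolating_curve (hmn : m ≤ n)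
    (hF : ContDiffAt ℝ ((n + 1 : ℕ) : WithTop ℕ∞)
      (fun p : ℝ × EuclideanSpace ℝ (Fin d) => F p.1 p.2) (0, x))
    (hFx : ∀ᶠ y in 𝓝 x, F 0 y = y)
    (hG : ContDiffAt ℝ ((n + 1 : ℕ) : WithTop ℕ∞)
      (fun p : ℝ × EuclideanSpace ℝ (Fin d) => G p.1 p.2) (0, x)) (hGx : G 0 x = x)
    (hFG : ∀ᶠ p in 𝓝 ((0 : ℝ), x), F p.1 (G p.1 p.2) = p.2)
    (hGF : ∀ᶠ p in 𝓝 ((0 : ℝ), x), G p.1 (F p.1 p.2) = p.2) :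
    ∃ (η η' : ℝ × EuclideanSpace ℝ (Fin d) → ℝ → EuclideanSpace ℝ (Fin d)) (K C : ℝ),
      ∀ᶠ p in 𝓝 ((0 : ℝ), x), ‖η p 0 - p.2‖ ≤ C * |p.1| ^ (m + 1) ∧
        ‖F p.1 p.2 - η p 1‖ ≤ C * |p.1| ^ (m + 1) ∧ ∀ t ∈ Icc (0 : ℝ) 1,
        HasDerivWithinAt (η p) (η' p t) (Icc 0 1) t ∧ ‖η p t - p.2‖ ≤ K * |p.1| ∧
        ‖η' p t - interpField n₀ m (F p.1) (G p.1) (η p t)‖ ≤ C * |p.1| ^ (m + 1) := by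
  have hFx' := hFx.self_of_nhds
  have hFc := hF.continuousAt
  have hGc := hG.continuousAt
  -- Evaluating the field at F^i(x) involves F^(k+i)(x) with k, i ≥ −n₀, hence the base point
  -- G^(2n₀)(x).
  set N := n₀ + n₀ with hN
  set z : ℝ × EuclideanSpace ℝ (Fin d) → ℝ × EuclideanSpace ℝ (Fin d) :=
    fun p => (p.1, (G p.1)^[N] p.2) with hz
  have hzt : Tendsto z (𝓝 (0, x)) (𝓝 (0, x)) := tendsto_fst_iterate hGc hGx N
  set Δ : ℕ → ℝ × EuclideanSpace ℝ (Fin d) → EuclideanSpace ℝ (Fin d) :=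
    fun j p => iterDiff F j (z p) with hΔdef
  set P : ℕ → ℝ[X] := shiftedChoose N with hPdef
  have hPdeg : ∀ j, (P j).natDegree ≤ j := natDegree_shiftedChoose_le N
  have hP0 : P 0 = 1 := by simp [hPdef, shiftedChoose]
  have hΔ' : ∀ j, Δ j =O[𝓝 (0, x)] fun p => p.1 ^ min j (n + 1) := fun j =>
    (iterDiff_isBigO hF hFx j).comp_tendsto hzt
  set Q : ℝ × EuclideanSpace ℝ (Fin d) → ℝ → EuclideanSpace ℝ (Fin d) :=
    fun p t => ∑ j ∈ Finset.range (m + 1), (P j).eval t • Δ j p with hQ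
  set Q' : ℝ × EuclideanSpace ℝ (Fin d) → ℝ → EuclideanSpace ℝ (Fin d) :=
    fun p t => ∑ j ∈ Finset.range (m + 1), (derivative (P j)).eval t • Δ j p with hQ'
  -- Newton's formula cut after degree m. It serves every integer k ≥ −N, so also k + i and k = 1,
  -- which need not be nodes.
  have hnewton : ∀ k : ℤ, -(N : ℤ) ≤ k →
      (fun p => (F p.1)^[(k + N).toNat] (z p).2 - Q p k) =O[𝓝 (0, x)] fun p => p.1 ^ (m + 1) := by
    intro k hk
    have e : ∀ p, (F p.1)^[(k + N).toNat] (z p).2 - Q p k =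
        ∑ j ∈ Finset.Ico (m + 1) (m + 1 + ((k + N).toNat + 1)),
          ((k + N).toNat.choose j : ℝ) • Δ j p := by
      intro p
      have h1 := iterate_eq_sum_iterDiff F (z p)
        (show (k + N).toNat < m + 1 + ((k + N).toNat + 1) by omega)
      rw [← Finset.sum_range_add_sum_Ico _ (show m + 1 ≤ m + 1 + ((k + N).toNat + 1) by omega)] at h1
      change (F p.1)^[_] (z p).2 = _ at h1
      rw [h1, sub_eq_iff_eq_add', hQ]
      simp only [hPdef, eval_shiftedChoose N _ hk, hΔdef]
    simp only [e]
    refine IsBigO.fun_sum fun j hj => ((hΔ' j).trans ?_).const_smul_left ((k + N).toNat.choose j : ℝ)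
    exact isBigO_pow_of_le (le_min (Finset.mem_Ico.1 hj).1 (by omega))
  have hiter : ∀ k : ℤ, -(N : ℤ) ≤ k →
      (fun p : ℝ × EuclideanSpace ℝ (Fin d) => intIterate (F p.1) (G p.1) k p.2 - Q p k)
        =O[𝓝 (0, x)] fun p => p.1 ^ (m + 1) := by
    intro k hk
    refine (hnewton k hk).congr' ?_ EventuallyEq.rfl
    filter_upwards [eventually_intIterate_eq hFc hFx' hGc hGx hFG hGF hk] with p hp
    rw [hp]
  have hQ0 : (fun p => Q p 0 - p.2) =O[𝓝 (0, x)] fun p => p.1 ^ (m + 1) := by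
    have h := (hiter 0 (by omega)).neg_left
    simp only [neg_sub, Int.cast_zero] at h
    exact h
  have hQ1 : (fun p => F p.1 p.2 - Q p 1) =O[𝓝 (0, x)] fun p => p.1 ^ (m + 1) := by
    have h := hiter 1 (by omega)
    simp only [Int.cast_one] at h
    exact h
  have hX := contDiffAt_interpField n₀ m hF hFx' hG hGx
  have hnode : ∀ i ∈ nodes n₀ m, (fun p : ℝ × EuclideanSpace ℝ (Fin d) =>
      Q' p i - interpField n₀ m (F p.1) (G p.1) (Q p i)) =O[𝓝 (0, x)] fun p => p.1 ^ (m + 1) := by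
    intro i hi
    have hi0 : -(n₀ : ℤ) ≤ i := (Finset.mem_Icc.1 hi).1
    have h1 : (fun p : ℝ × EuclideanSpace ℝ (Fin d) =>
        Q' p i - interpField n₀ m (F p.1) (G p.1) (intIterate (F p.1) (G p.1) i p.2))
        =O[𝓝 (0, x)] fun p => p.1 ^ (m + 1) := by
      have h2 : (fun p => ∑ k ∈ nodes n₀ m, weight n₀ m k •
          ((F p.1)^[(k + i + N).toNat] (z p).2 - Q p ((k + i : ℤ) : ℝ)))
          =O[𝓝 (0, x)] fun p => p.1 ^ (m + 1) := by
        refine IsBigO.fun_sum fun k hk => (hnewton (k + i) ?_).const_smul_left (weight n₀ m k)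
        have := (Finset.mem_Icc.1 hk).1
        omega
      refine h2.neg_left.congr' ?_ EventuallyEq.rfl
      have hall := (Filter.eventually_all_finset (nodes n₀ m)).2 fun k hk =>
        eventually_intIterate_intIterate_eq hFc hFx' hGc hGx hFG hGF (Finset.mem_Icc.1 hk).1 hi0
      filter_upwards [hall] with p hp
      have hQsum : ∑ k ∈ nodes n₀ m, weight n₀ m k • Q p ((k + i : ℤ) : ℝ) = Q' p i := by
        simp only [hQ, hQ', Finset.smul_sum, smul_smul]
        rw [Finset.sum_comm]
        refine Finset.sum_congr rfl fun j hj => ?_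
        rw [← Finset.sum_smul]
        congr 1
        push_cast
        exact sum_weight_mul_eval ((hPdeg j).trans (Nat.lt_succ_iff.1 (Finset.mem_range.1 hj))) _
      simp only [smul_sub, Finset.sum_sub_distrib, hQsum, neg_sub]
      congr 1
      exact Finset.sum_congr rfl fun k hk => by rw [hp k hk]
    have hit := contDiffAt_intIterate hF hFx' hG hGx i
    have hdiff := hiter i (by omega)
    have t1 : Tendsto (fun p : ℝ × EuclideanSpace ℝ (Fin d) =>
        intIterate (F p.1) (G p.1) i p.2) (𝓝 (0, x)) (𝓝 x) := by
      have := hit.continuousAt.tendsto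
      rwa [intIterate_fixed hFx' hGx] at this
    have t0 : Tendsto (fun p : ℝ × EuclideanSpace ℝ (Fin d) => p.1 ^ (m + 1)) (𝓝 (0, x)) (𝓝 0) :=
      Continuous.tendsto' (by fun_prop) _ _ (by simp)
    have t2 : Tendsto (fun p => Q p i) (𝓝 (0, x)) (𝓝 x) := by
      have := t1.sub (hdiff.trans_tendsto t0)
      simpa using this
    have te : Tendsto (fun p : ℝ × EuclideanSpace ℝ (Fin d) => p.1) (𝓝 (0, x)) (𝓝 0) :=
      continuousAt_fst
    -- The field is locally Lipschitz, so F^i(x) may be replaced by Q(i) in its argument.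
    have h3 := ((hX.hasStrictFDerivAt (by simp)).isBigO_sub.comp_tendsto
      ((te.prodMk_nhds t1).prodMk_nhds (te.prodMk_nhds t2)))
    have h4 := h3.trans ((IsBigO.of_bound 1 (Eventually.of_forall fun p => by simp)).trans hdiff)
    refine (h1.add h4).congr_left fun p => ?_
    simp
  obtain ⟨K, C, hKC⟩ := polynomial_curve_estimate (n₀ := n₀) (m := m)
    (hX.of_le (by norm_cast; omega)) hPdeg hP0 (Δ := Δ)
    (fun j hj => by simpa [min_eq_left (show j ≤ n + 1 by omega)] using hΔ' j)
    (hQ0.trans (by simpa using isBigO_pow_of_le (x := x) (show 1 ≤ m + 1 by omega))) hnode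
  obtain ⟨C₀, hC₀⟩ := hQ0.bound
  obtain ⟨C₁, hC₁⟩ := hQ1.bound
  refine ⟨Q, Q', K, max C (max C₀ C₁), ?_⟩
  filter_upwards [hKC, hC₀, hC₁] with p h1 h2 h3
  rw [norm_pow, Real.norm_eq_abs] at h2 h3
  refine ⟨h2.trans ?_, h3.trans ?_, fun t ht => ⟨?_, (h1 t ht).1, (h1 t ht).2.trans ?_⟩⟩
  · gcongr
    exact (le_max_left _ _).trans (le_max_right _ _)
  · gcongr
    exact (le_max_right _ _).trans (le_max_right _ _)
  · exact (hasDerivAt_sum_eval_smul _ P (fun j => Δ j p) t).hasDerivWithinAt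
  · gcongr
    exact le_max_left _ _

end InterpField

end DiscreteAveraging

namespace DiscreteAveraging

open Filter Topology Asymptotics Set Metric

/-! ### Uniqueness and Taylor truncation of polynomial fields -/

section PolyField

variable {d n : ℕ} {D : Set (EuclideanSpace ℝ (Fin d))} {x : EuclideanSpace ℝ (Fin d)}
  {F : ℝ → EuclideanSpace ℝ (Fin d) → EuclideanSpace ℝ (Fin d)}

lemma contDiffAt_comp_snd {V : Type*} [NormedAddCommGroup V] [NormedSpace ℝ V]
    {E : Type*} [NormedAddCommGroup E] [NormedSpace ℝ E] {x : E} {g : E → V} {r : WithTop ℕ∞}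
    (hg : ContDiffAt ℝ r g x) : ContDiffAt ℝ r (fun p : ℝ × E => g p.2) (0, x) :=
  ContDiffAt.comp (g := g) (f := fun p : ℝ × E => p.2) ((0 : ℝ), x) hg contDiffAt_snd

lemma contDiffAt_sum_pow_smul {g : Fin n → EuclideanSpace ℝ (Fin d) → EuclideanSpace ℝ (Fin d)}
    (hg : ∀ k, ContDiffAt ℝ 1 (g k) x) :
    ContDiffAt ℝ 1 (fun p : ℝ × EuclideanSpace ℝ (Fin d) =>
      ∑ k : Fin n, p.1 ^ (k : ℕ) • g k p.2) (0, x) :=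
  ContDiffAt.sum fun k _ => (contDiffAt_fst.pow _).fun_smul (contDiffAt_comp_snd (hg k))

lemma contDiffAt_polyField {g : Fin n → EuclideanSpace ℝ (Fin d) → EuclideanSpace ℝ (Fin d)}
    (hg : ∀ k, ContDiffAt ℝ 1 (g k) x) :
    ContDiffAt ℝ 1 (fun p : ℝ × EuclideanSpace ℝ (Fin d) => polyField g p.1 p.2) (0, x) :=
  contDiffAt_fst.fun_smul (contDiffAt_sum_pow_smul hg)

lemma polyField_zero (g : Fin n → EuclideanSpace ℝ (Fin d) → EuclideanSpace ℝ (Fin d))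
    (y : EuclideanSpace ℝ (Fin d)) : polyField g 0 y = 0 := by
  simp [polyField]

lemma polyField_sub_isBigO {g h : Fin n → EuclideanSpace ℝ (Fin d) → EuclideanSpace ℝ (Fin d)}
    (hg : ∀ k, ContinuousAt (g k) x) (hh : ∀ k, ContinuousAt (h k) x) (k : Fin n)
    (heq : ∀ i < k, ∀ᶠ y in 𝓝 x, h i y = g i y) :
    (fun p : ℝ × EuclideanSpace ℝ (Fin d) => polyField h p.1 p.2 +
      p.1 ^ ((k : ℕ) + 1) • (g k p.2 - h k p.2) - polyField g p.1 p.2)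
      =O[𝓝 (0, x)] fun p => p.1 ^ ((k : ℕ) + 2) := by
  have ty : Tendsto (fun p : ℝ × EuclideanSpace ℝ (Fin d) => p.2) (𝓝 (0, x)) (𝓝 x) :=
    continuousAt_snd
  have e : ∀ p : ℝ × EuclideanSpace ℝ (Fin d), polyField h p.1 p.2 +
      p.1 ^ ((k : ℕ) + 1) • (g k p.2 - h k p.2) - polyField g p.1 p.2 =
      ∑ i ∈ Finset.univ.erase k, p.1 ^ ((i : ℕ) + 1) • (h i p.2 - g i p.2) := by
    intro p
    have h1 : polyField h p.1 p.2 - polyField g p.1 p.2 =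
        ∑ i : Fin n, p.1 ^ ((i : ℕ) + 1) • (h i p.2 - g i p.2) := by
      simp only [polyField, Finset.smul_sum, smul_smul, ← pow_succ', smul_sub,
        Finset.sum_sub_distrib]
    rw [← Finset.add_sum_erase _ _ (Finset.mem_univ k)] at h1
    rw [add_sub_right_comm, h1, smul_sub, smul_sub]
    abel
  simp only [e]
  refine IsBigO.fun_sum fun i hi => ?_
  rcases lt_or_gt_of_ne (Finset.ne_of_mem_erase hi) with hik | hik
  · refine (isBigO_zero _ _).congr' ?_ EventuallyEq.rfl
    filter_upwards [ty.eventually (heq i hik)] with p hp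
    rw [hp, sub_self, smul_zero]
  · have h1 : (fun p : ℝ × EuclideanSpace ℝ (Fin d) => h i p.2 - g i p.2) =O[𝓝 (0, x)]
        fun _ => (1 : ℝ) :=
      (((hh i).tendsto.comp ty).sub ((hg i).tendsto.comp ty)).isBigO_one ℝ
    have h2 := (isBigO_pow_of_le (x := x)
      (show (k : ℕ) + 2 ≤ (i : ℕ) + 1 by have : (k : ℕ) < i := hik; omega)).smul h1
    simpa using h2

/-- Strong induction on `k`. With equal lower coefficients, the two flows differ at time 1 by
ε^(k+1)(g_k − h_k)(x) + O(ε^(k+2)), yet both are within O(ε^(n+1)) of F_ε and k + 2 ≤ n + 1. -/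
lemma eqOn_of_approxByFlow_polyField (hD : IsOpen D)
    {g h : Fin n → EuclideanSpace ℝ (Fin d) → EuclideanSpace ℝ (Fin d)}
    (hg : ∀ k, ContDiffOn ℝ 1 (g k) D) (hh : ∀ k, ContDiffOn ℝ 1 (h k) D)
    (hgF : ApproxByFlow D F (polyField g) (n + 1)) (hhF : ApproxByFlow D F (polyField h) (n + 1))
    (k : Fin n) : EqOn (h k) (g k) D := by
  induction k using WellFoundedLT.induction with
  | ind k ih =>
  intro x hx
  have hDx := hD.mem_nhds hx
  have hgx : ∀ k, ContDiffAt ℝ 1 (g k) x := fun k => (hg k).contDiffAt hDx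
  have hhx : ∀ k, ContDiffAt ℝ 1 (h k) x := fun k => (hh k).contDiffAt hDx
  have hX0 := Eventually.of_forall (f := 𝓝 x) (polyField_zero g)
  have hY0 := Eventually.of_forall (f := 𝓝 x) (polyField_zero h)
  obtain ⟨σ, K, hσ⟩ := exists_flow_curve hDx (contDiffAt_polyField hhx) hY0
  obtain ⟨γ, Kγ, hγ⟩ := exists_flow_curve hDx (contDiffAt_polyField hgx) hX0
  obtain ⟨C₁, hC₁⟩ := (polyField_sub_isBigO (fun k => (hgx k).continuousAt)
    (fun k => (hhx k).continuousAt) k fun i hi => by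
      filter_upwards [hDx] with y hy using ih i hi hy).bound
  set w : EuclideanSpace ℝ (Fin d) → EuclideanSpace ℝ (Fin d) := fun y => g k y - h k y with hw
  have hwx : ContDiffAt ℝ 1 w x := (hgx k).sub (hhx k)
  obtain ⟨L₁, s₁, hs₁, hL₁⟩ := hwx.exists_lipschitzOnWith
  obtain ⟨L₂, s₂, hs₂, hL₂⟩ := (contDiffAt_sum_pow_smul hgx).exists_lipschitzOnWith
  set W : ℝ := ‖w x‖ + 1 with hW
  have ty : Tendsto (fun p : ℝ × EuclideanSpace ℝ (Fin d) => p.2) (𝓝 (0, x)) (𝓝 x) :=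
    continuousAt_snd
  have hWb : ∀ᶠ p in 𝓝 ((0 : ℝ), x), ‖w p.2‖ ≤ W :=
    ty.eventually ((hwx.continuousAt.norm.eventually_lt_const (lt_add_one _)).mono
      fun _ => le_of_lt)
  have hW0 : 0 ≤ W := by positivity
  -- The solution for `h` plus a linear drift supplying the missing leading term: it solves the
  -- equation of `g` up to O(ε^(k+2)).
  set η : ℝ × EuclideanSpace ℝ (Fin d) → ℝ → EuclideanSpace ℝ (Fin d) :=
    fun p t => σ p t + t • (p.1 ^ ((k : ℕ) + 1) • w p.2) with hη
  set η' : ℝ × EuclideanSpace ℝ (Fin d) → ℝ → EuclideanSpace ℝ (Fin d) :=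
    fun p t => polyField h p.1 (σ p t) + p.1 ^ ((k : ℕ) + 1) • w p.2 with hη'
  set C : ℝ := |C₁| + L₁ * |K| + L₂ * W with hC
  have happ : ∀ᶠ p in 𝓝 ((0 : ℝ), x), ‖η p 0 - p.2‖ ≤ C * |p.1| ^ ((k : ℕ) + 2) ∧
      ∀ t ∈ Icc (0 : ℝ) 1, HasDerivWithinAt (η p) (η' p t) (Icc 0 1) t ∧
        ‖η p t - p.2‖ ≤ (K + W) * |p.1| ∧
        ‖η' p t - polyField g p.1 (η p t)‖ ≤ C * |p.1| ^ ((k : ℕ) + 2) := by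
    filter_upwards [hσ, eventually_forall_of_norm_sub_le hC₁ K, hWb, eventually_abs_fst_le_one x,
      eventually_forall_of_norm_sub_le (ty hs₁) K, ty hs₁, eventually_forall_of_norm_sub_le hs₂ K,
      eventually_forall_of_norm_sub_le hs₂ (K + W)] with p h1 h2 h3 h4 h5 h6 h7 h8
    have hstep : ∀ t ∈ Icc (0 : ℝ) 1,
        ‖t • (p.1 ^ ((k : ℕ) + 1) • w p.2)‖ ≤ |p.1| ^ ((k : ℕ) + 1) * W := by
      intro t ht
      rw [norm_smul, norm_smul, norm_pow, Real.norm_eq_abs, Real.norm_eq_abs, abs_of_nonneg ht.1]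
      refine (mul_le_of_le_one_left (by positivity) ht.2).trans ?_
      gcongr
    refine ⟨?_, fun t ht => ?_⟩
    · have : η p 0 - p.2 = 0 := by simp [hη, h1.1]
      rw [this, norm_zero]
      positivity
    obtain ⟨h1a, h1b, h1c⟩ := h1.2 t ht
    have hηt : ‖η p t - p.2‖ ≤ (K + W) * |p.1| := by
      have e : η p t - p.2 = (σ p t - p.2) + t • (p.1 ^ ((k : ℕ) + 1) • w p.2) := by
        simp only [hη]
        abel
      rw [e, add_mul]
      refine (norm_add_le _ _).trans (add_le_add h1c ((hstep t ht).trans ?_))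
      rw [mul_comm]
      gcongr
      exact pow_le_of_le_one (abs_nonneg _) h4 (by omega)
    refine ⟨h1b.add ?_, hηt, ?_⟩
    · have := ((hasDerivAt_id t).smul_const (p.1 ^ ((k : ℕ) + 1) • w p.2)).hasDerivWithinAt
        (s := Icc (0 : ℝ) 1)
      simpa using this
    -- Three errors: higher coefficients, freezing `w` at the starting point, and the drift inside
    -- `polyField g`, whose own factor ε supplies the last power.
    have e : η' p t - polyField g p.1 (η p t) =
        (polyField h p.1 (σ p t) + p.1 ^ ((k : ℕ) + 1) • w (σ p t) - polyField g p.1 (σ p t)) +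
        p.1 ^ ((k : ℕ) + 1) • (w p.2 - w (σ p t)) +
        (polyField g p.1 (σ p t) - polyField g p.1 (η p t)) := by
      simp only [hη', smul_sub]
      abel
    rw [e, hC, add_mul, add_mul]
    refine (norm_add₃_le).trans (add_le_add (add_le_add ?_ ?_) ?_)
    · refine (h2 _ h1c).trans ?_
      rw [norm_pow, Real.norm_eq_abs]
      gcongr
      exact le_abs_self _
    · have hLip := hL₁.norm_sub_le h6 (h5 _ h1c)
      rw [norm_sub_rev p.2] at hLip
      rw [norm_smul, norm_pow, Real.norm_eq_abs]
      calc |p.1| ^ ((k : ℕ) + 1) * ‖w p.2 - w (σ p t)‖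
          ≤ |p.1| ^ ((k : ℕ) + 1) * (L₁ * (|K| * |p.1|)) := by
            gcongr
            refine hLip.trans ?_
            gcongr
            exact h1c.trans (by gcongr; exact le_abs_self _)
        _ = L₁ * |K| * |p.1| ^ ((k : ℕ) + 2) := by ring
    · have hLip := hL₂.norm_sub_le (h7 _ h1c) (h8 _ hηt)
      have hd : ‖(p.1, σ p t) - (p.1, η p t)‖ ≤ |p.1| ^ ((k : ℕ) + 1) * W := by
        have : (p.1, σ p t) - (p.1, η p t) = (0, -(t • (p.1 ^ ((k : ℕ) + 1) • w p.2))) := by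
          simp [hη]
        rw [this, Prod.norm_def, norm_zero, norm_neg]
        exact max_le (by positivity) (hstep t ht)
      simp only [polyField, ← smul_sub]
      rw [norm_smul, Real.norm_eq_abs]
      calc _ ≤ |p.1| * (L₂ * (|p.1| ^ ((k : ℕ) + 1) * W)) := by
            gcongr
            exact hLip.trans (by gcongr)
        _ = L₂ * W * |p.1| ^ ((k : ℕ) + 2) := by ring
  obtain ⟨M, hM⟩ := exists_norm_sub_le_of_approx_solution (contDiffAt_polyField hgx) hX0 happ
  obtain ⟨C₂, hC₂⟩ := hgF.eventually hD hx
  obtain ⟨C₃, hC₃⟩ := hhF.eventually hD hx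
  have hk : (k : ℕ) + 2 ≤ n + 1 := by have := k.2; omega
  have hfin : ∀ᶠ p in 𝓝 ((0 : ℝ), x),
      ‖p.1 ^ ((k : ℕ) + 1) • w p.2‖ ≤ (M * C + |C₂| + |C₃|) * |p.1| ^ ((k : ℕ) + 2) := by
    filter_upwards [hM, hC₂, hC₃, hσ, hγ, eventually_abs_fst_le_one x] with p h1 h2 h3 h4 h5 h6
    have a1 := h1 (γ p) h5.1 fun t ht => (h5.2 t ht).2.1
    have a2 := h2 _ ⟨γ p, h5.1, rfl, fun t ht => ⟨(h5.2 t ht).1, (h5.2 t ht).2.1⟩⟩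
    have a3 := h3 _ ⟨σ p, h4.1, rfl, fun t ht => ⟨(h4.2 t ht).1, (h4.2 t ht).2.1⟩⟩
    have hpow : ∀ c : ℝ, c * |p.1| ^ (n + 1) ≤ |c| * |p.1| ^ ((k : ℕ) + 2) := by
      intro c
      calc c * |p.1| ^ (n + 1) ≤ |c| * |p.1| ^ (n + 1) := by gcongr; exact le_abs_self _
        _ ≤ |c| * |p.1| ^ ((k : ℕ) + 2) := by
          gcongr ?_ * ?_
          exact pow_le_pow_of_le_one (abs_nonneg _) h6 hk
    have e : p.1 ^ ((k : ℕ) + 1) • w p.2 =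
        (η p 1 - γ p 1) - (F p.1 p.2 - γ p 1) + (F p.1 p.2 - σ p 1) := by
      simp only [hη, one_smul]
      abel
    rw [e, add_mul, add_mul]
    refine (norm_add_le _ _).trans (add_le_add ((norm_sub_le _ _).trans (add_le_add a1 ?_)) ?_)
    · exact a2.trans (hpow _)
    · exact a3.trans (hpow _)
  have tx : Tendsto (fun ε : ℝ => (ε, x)) (𝓝[≠] 0) (𝓝 (0, x)) :=
    tendsto_nhdsWithin_of_tendsto_nhds (Continuous.tendsto' (by fun_prop) _ _ rfl)
  have hlim : Tendsto (fun ε : ℝ => (M * C + |C₂| + |C₃|) * |ε|) (𝓝[≠] 0) (𝓝 0) :=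
    tendsto_nhdsWithin_of_tendsto_nhds (Continuous.tendsto' (by fun_prop) _ _ (by simp))
  have hle : ∀ᶠ ε : ℝ in 𝓝[≠] 0, ‖w x‖ ≤ (M * C + |C₂| + |C₃|) * |ε| := by
    filter_upwards [tx.eventually hfin, self_mem_nhdsWithin] with ε h1 h2
    have hpos : 0 < |ε| ^ ((k : ℕ) + 1) := pow_pos (abs_pos.2 h2) _
    simp only [norm_smul, norm_pow, Real.norm_eq_abs] at h1
    refine le_of_mul_le_mul_left (h1.trans_eq ?_) hpos
    ring
  have hw0 : ‖w x‖ ≤ 0 := ge_of_tendsto hlim hle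
  exact (sub_eq_zero.1 (norm_le_zero_iff.1 hw0)).symm

/-- The coefficient of `ε ^ (k + 1)` in the Taylor expansion of `X` at `ε = 0`. -/
noncomputable def taylorField (X : ℝ → EuclideanSpace ℝ (Fin d) → EuclideanSpace ℝ (Fin d))
    (k : ℕ) (y : EuclideanSpace ℝ (Fin d)) : EuclideanSpace ℝ (Fin d) :=
  (1 / ((k + 1).factorial : ℝ)) •
    epsDeriv^[k + 1] (fun p : ℝ × EuclideanSpace ℝ (Fin d) => X p.1 p.2) (0, y)

variable {X : ℝ → EuclideanSpace ℝ (Fin d) → EuclideanSpace ℝ (Fin d)}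

/-- At most n of the n + 1 derivatives are spent in ε, leaving one for x. -/
lemma contDiffOn_taylorField (hX : ∀ x ∈ D, ContDiffAt ℝ ((n + 1 : ℕ) : WithTop ℕ∞)
      (fun p : ℝ × EuclideanSpace ℝ (Fin d) => X p.1 p.2) (0, x)) {k : ℕ} (hk : k < n) :
    ContDiffOn ℝ 1 (taylorField X k) D := by
  intro x hx
  refine ContDiffAt.contDiffWithinAt (ContDiffAt.const_smul (1 / ((k + 1).factorial : ℝ)) ?_)
  have h1 := contDiffAt_iterate_epsDeriv (k + 1) (r := 1)
    ((hX x hx).of_le (by norm_cast; omega))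
  exact ContDiffAt.comp x (by exact_mod_cast h1) (contDiffAt_const.prodMk contDiffAt_id)

lemma sub_polyField_taylorField_isBigO {j : ℕ} (hX : ContDiffAt ℝ ((j + 1 : ℕ) : WithTop ℕ∞)
      (fun p : ℝ × EuclideanSpace ℝ (Fin d) => X p.1 p.2) (0, x))
    (hX0 : ∀ᶠ y in 𝓝 x, X 0 y = 0) :
    (fun p : ℝ × EuclideanSpace ℝ (Fin d) =>
      X p.1 p.2 - polyField (fun k : Fin j => taylorField X k) p.1 p.2)
      =O[𝓝 (0, x)] fun p => p.1 ^ (j + 1) := by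
  have ty : Tendsto (fun p : ℝ × EuclideanSpace ℝ (Fin d) => p.2) (𝓝 (0, x)) (𝓝 x) :=
    continuousAt_snd
  refine (epsRem_isBigO (j + 1) hX).congr' ?_ EventuallyEq.rfl
  filter_upwards [ty.eventually hX0] with p hp
  rw [epsRem, Finset.sum_range_succ', polyField, Finset.smul_sum,
    ← Fin.sum_univ_eq_sum_range (fun i => (p.1 ^ (i + 1) / ((i + 1).factorial : ℝ)) •
      epsDeriv^[i + 1] (fun p : ℝ × EuclideanSpace ℝ (Fin d) => X p.1 p.2) (0, p.2)) j]
  simp only [Function.iterate_zero, id, hp, smul_zero, add_zero, taylorField, smul_smul]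
  congr 1
  refine Finset.sum_congr rfl fun i _ => ?_
  congr 1
  rw [pow_succ']
  ring

/-- Truncating at ε^j changes the field by O(ε^(j+1)), which `ApproxByFlow.congr` tolerates. -/
lemma approxByFlow_taylorField (hD : IsOpen D) {N j : ℕ}
    (hX : ∀ x ∈ D, ContDiffAt ℝ ((n + 1 : ℕ) : WithTop ℕ∞)
      (fun p : ℝ × EuclideanSpace ℝ (Fin d) => X p.1 p.2) (0, x))
    (hX0 : ∀ x ∈ D, X 0 x = 0) (hXF : ApproxByFlow D F X N) (hjn : j ≤ n) (hjN : j + 1 ≤ N) :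
    ApproxByFlow D F (polyField (fun k : Fin j => taylorField X k)) (j + 1) := by
  refine hXF.congr hD (fun x hx => (hX x hx).of_le (by norm_cast; omega)) hX0 (fun x hx => ?_)
    (fun x _ => polyField_zero _ x) hjN (fun x hx => ?_)
  · exact contDiffAt_polyField fun k =>
      (contDiffOn_taylorField hX (k.2.trans_le hjn)).contDiffAt (hD.mem_nhds hx)
  · exact sub_polyField_taylorField_isBigO ((hX x hx).of_le (by norm_cast; omega))
      (by filter_upwards [hD.mem_nhds hx] with y hy using hX0 y hy)

end PolyField

end DiscreteAveraging

/-! ### Assembly of the theorem -/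

open DiscreteAveraging Filter Topology Set in
theorem mainTheorem1 (d n : ℕ) (D : Set (EuclideanSpace ℝ (Fin d))) (hD : IsOpen D)
    (ε₀ : ℝ) (hε₀ : 0 < ε₀)
    (F : ℝ → EuclideanSpace ℝ (Fin d) → EuclideanSpace ℝ (Fin d))
    (hF : ContDiffOn ℝ ((n + 1 : ℕ) : WithTop ℕ∞)
      (fun p : EuclideanSpace ℝ (Fin d) × ℝ => F p.2 p.1) (D ×ˢ Set.Icc (-ε₀) ε₀))
    (hF0 : ∀ x ∈ D, F 0 x = x) :
    (∃ G, DiscreteAveraging.IsInverseFamily D F G) ∧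
    ∃ g : Fin n → EuclideanSpace ℝ (Fin d) → EuclideanSpace ℝ (Fin d),
      (∀ k, ContDiffOn ℝ 1 (g k) D) ∧
      DiscreteAveraging.ApproxByFlow D F (DiscreteAveraging.polyField g) (n + 1) ∧
      (∀ h : Fin n → EuclideanSpace ℝ (Fin d) → EuclideanSpace ℝ (Fin d),
        (∀ k, ContDiffOn ℝ 1 (h k) D) →
        DiscreteAveraging.ApproxByFlow D F (DiscreteAveraging.polyField h) (n + 1) →
        ∀ k, Set.EqOn (h k) (g k) D) ∧
      ∀ G, DiscreteAveraging.IsInverseFamily D F G →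
        ∀ m n₀ : ℕ, 1 ≤ m → m ≤ n → n₀ ≤ m →
          (∀ k : Fin n, (k : ℕ) + 1 ≤ m → ∀ x ∈ D,
            ContDiffAt ℝ (((k : ℕ) + 1 : ℕ) : WithTop ℕ∞)
              (fun ε => DiscreteAveraging.interpField n₀ m (F ε) (G ε) x) 0 ∧
            (1 / (((k : ℕ) + 1).factorial : ℝ)) •
              iteratedDeriv ((k : ℕ) + 1)
                (fun ε => DiscreteAveraging.interpField n₀ m (F ε) (G ε) x) 0 = g k x) ∧
          DiscreteAveraging.ApproxByFlow D F
            (fun ε => DiscreteAveraging.interpField n₀ m (F ε) (G ε)) (m + 1) := by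
  have hF' : ∀ x ∈ D, ContDiffAt ℝ ((n + 1 : ℕ) : WithTop ℕ∞)
      (fun p : ℝ × EuclideanSpace ℝ (Fin d) => F p.1 p.2) (0, x) := by
    intro x hx
    have h1 := hF.contDiffAt (x := (x, (0 : ℝ)))
      (prod_mem_nhds (hD.mem_nhds hx) (Icc_mem_nhds (neg_lt_zero.2 hε₀) hε₀))
    exact ContDiffAt.comp (g := fun p : EuclideanSpace ℝ (Fin d) × ℝ => F p.2 p.1)
      (f := fun p : ℝ × EuclideanSpace ℝ (Fin d) => (p.2, p.1)) ((0 : ℝ), x) h1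
      (contDiffAt_snd.prodMk contDiffAt_fst)
  have hXs : ∀ G, IsInverseFamily D F G → ∀ m n₀ : ℕ, ∀ x ∈ D,
      ContDiffAt ℝ ((n + 1 : ℕ) : WithTop ℕ∞) (fun p : ℝ × EuclideanSpace ℝ (Fin d) =>
        interpField n₀ m (F p.1) (G p.1) p.2) (0, x) := by
    intro G hG m n₀ x hx
    obtain ⟨h1, h2, -⟩ := hG.contDiffAt hD hF' hF0 hx
    exact contDiffAt_interpField n₀ m (hF' x hx) (hF0 x hx) h1 h2
  have hX0 : ∀ G, IsInverseFamily D F G → ∀ m n₀ : ℕ, ∀ x ∈ D,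
      interpField n₀ m (F 0) (G 0) x = 0 := fun G hG m n₀ x hx =>
    interpField_eq_zero n₀ m (hF0 x hx) (hG.contDiffAt hD hF' hF0 hx).2.1
  have hXF : ∀ G, IsInverseFamily D F G → ∀ m n₀ : ℕ, m ≤ n →
      ApproxByFlow D F (fun ε => interpField n₀ m (F ε) (G ε)) (m + 1) := by
    intro G hG m n₀ hmn
    refine approxByFlow_of_approx_solution hD
      (fun x hx => (hXs G hG m n₀ x hx).of_le (by norm_cast; omega)) (hX0 G hG m n₀) fun x hx => ?_
    obtain ⟨h1, h2, h3, h4⟩ := hG.contDiffAt hD hF' hF0 hx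
    exact exists_interpolating_curve hmn (hF' x hx)
      (by filter_upwards [hD.mem_nhds hx] with y hy using hF0 y hy) h1 h2 h3 h4
  obtain ⟨G₀, hG₀⟩ := exists_isInverseFamily hD hF' hF0
  -- The choice n₀ = 0 uses only forward iterates, so the resulting g does not depend on `G₀`.
  set X₀ : ℝ → EuclideanSpace ℝ (Fin d) → EuclideanSpace ℝ (Fin d) :=
    fun ε => interpField 0 n (F ε) (G₀ ε) with hX₀
  have hT : ∀ j ≤ n, ApproxByFlow D F (polyField (fun k : Fin j => taylorField X₀ k)) (j + 1) :=
    fun j hj => approxByFlow_taylorField hD (hXs G₀ hG₀ n 0) (hX0 G₀ hG₀ n 0)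
      (hXF G₀ hG₀ n 0 le_rfl) hj (by omega)
  have hg : ∀ k : Fin n, ContDiffOn ℝ 1 (taylorField X₀ k) D := fun k =>
    contDiffOn_taylorField (hXs G₀ hG₀ n 0) k.2
  refine ⟨⟨G₀, hG₀⟩, fun k => taylorField X₀ k, hg, hT n le_rfl,
    fun h hh hhF k => eqOn_of_approxByFlow_polyField hD hg hh (hT n le_rfl) hhF k,
    fun G hG m n₀ _ hmn _ => ⟨fun k hkm x hx => ?_, hXF G hG m n₀ hmn⟩⟩
  have hs := hXs G hG m n₀ x hx
  have hsk : ContDiffAt ℝ (((k : ℕ) + 1 : ℕ) : WithTop ℕ∞)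
      (fun p : ℝ × EuclideanSpace ℝ (Fin d) => interpField n₀ m (F p.1) (G p.1) p.2) (0, x) :=
    hs.of_le (by norm_cast; omega)
  refine ⟨?_, ?_⟩
  · exact ContDiffAt.comp (g := fun p : ℝ × EuclideanSpace ℝ (Fin d) =>
      interpField n₀ m (F p.1) (G p.1) p.2) (f := fun ε : ℝ => (ε, x)) (0 : ℝ) hsk
      (contDiffAt_id.prodMk contDiffAt_const)
  · have h1 := iteratedDeriv_eq_iterate_epsDeriv ((k : ℕ) + 1) hsk
    simp only at h1
    rw [h1]
    -- Uniqueness among fields with m coefficients: the truncations of X₀ and X_m at ε^m both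
    -- approximate F_ε to order m + 1.
    exact eqOn_of_approxByFlow_polyField hD
      (g := fun i : Fin m => taylorField X₀ i)
      (h := fun i : Fin m => taylorField (fun ε => interpField n₀ m (F ε) (G ε)) i)
      (fun i => hg ⟨i, i.2.trans_le hmn⟩)
      (fun i => contDiffOn_taylorField (hXs G hG m n₀) (i.2.trans_le hmn)) (hT m hmn)
      (approxByFlow_taylorField hD (hXs G hG m n₀) (hX0 G hG m n₀) (hXF G hG m n₀ hmn) hmn le_rfl)
      ⟨k, hkm⟩ hx
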